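/- All vector spaces are over $\mathbb{C}$ and lcHs means locally convex Hausdorff space. An inductive spectrum of Banach spaces is a sequence $\mathscr{Z}=(Z_n)_{n\in\mathbb{N}}$ of Banach spaces with $Z_n\subseteq Z_{n+1}$ and continuous inclusion maps; its inductive limit $\operatorname{Ind}\mathscr{Z}$ is $\bigcup_n Z_n$ with the finest locally convex topology making all inclusion maps $Z_n\to\bigcup_n Z_n$ continuous. An $(LB)$-space is a Hausdorff space of the form $Z=\operatorname{Ind}\mathscr{Z}$ with $\mathscr{Z}$ an inductive spectrum of Banach spaces; it is an $(LN)$-space if $\mathscr{Z}$ can be chosen such that all inclusion maps $Z_n\to Z_{n+1}$ are nuclear. For an arbitrary index set $I$ and a sequence $A=(a_n)_{n\in\mathbb{N}}$ of positive functions on $I$ with $a_{n+1}\le a_n$, put, for $p\in\{1,\infty\}$, $k^p(A)=\operatorname{Ind}(\ell^p(a_n))_{n\in\mathbb{N}}$, where $\ell^p(a)=\{c\in\mathbb{C}^I : \|c\|_{\ell^p(a)}=\|ac\|_{\ell^p(I)}<\infty\}$. A lcHs $E$ is locally complete if every bounded subset of $E$ is contained in an absolutely convex bounded set $B$ such that the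 span of $B$, normed by the Minkowski functional of $B$, is complete. A fundamental sequence of bounded sets in $E$ is a sequence of bounded sets such that every bounded set is contained in one of them. A lcHs $E$ with a fundamental increasing sequence $(B_N)_{N\in\mathbb{N}}$ of bounded sets satisfies condition (A) if $$\exists N\ \forall M\ge N\ \forall \nu>0\ \exists K\ge M,\ C>0\ \forall r>0:\quad B_M\subseteq rB_K+\frac{C}{r^{\nu}}B_N$$ (this does not depend on the choice of $(B_N)_N$). An $(LB)$-space $Z=\operatorname{Ind}(Z_n)_{n\in\mathbb{N}}$ satisfies condition $(D\Omega)$ if $$\forall n\ \exists m\ge n\ \forall k\ge m\ \exists\theta\in(0,1),\ C>0\ \forall z\in Z_n:\quad \|z\|_{Z_m}\le C\|z\|_{Z_n}^{\theta}\|z\|_{Z_k}^{1-\theta}$$ (this does not depend on the choice of the spectrum of Banach spaces defining $Z$). For a lcHs $E$, an $(LB)$-space $Z$ is weakly $E$-acyclic if for every algebraically exact sequence $0\to X\xrightarrow{\iota}Y\xrightarrow{Q}Z\to0$ of $(LB)$-spaces and continuous linear maps, the map $L(Y,E)\to L(X,E)$, $T\mapsto T\circ\iota$, between spaces of continuous linear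 maps is surjective. **Theorem.** Let $E$ be a locally complete lcHs with a fundamental sequence of bounded sets and let $Z$ be an $(LB)$-space. Suppose that one of the following holds: (a) $E\cong k^\infty(A)$ for some $A$ as above; (b) $E$ is an $(LN)$-space; (c) $Z\cong k^1(A)$ for some $A$ as above; (d) $Z$ is an $(LN)$-space. If $E$ satisfies condition (A) and $Z$ satisfies condition $(D\Omega)$, then $Z$ is weakly $E$-acyclic. -/

import Mathlib

open Set Filter Topology Bornology
open scoped Pointwise ENNReal

universe uX uY uZ uE

noncomputable section

/-! ### Inductive limits and (LB)-spaces -/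

/-- The finest locally convex topology on `X` (i.e. the finest vector space topology that is
locally convex) making all the linear maps `ι n : F n → X` continuous. In Mathlib's order on
topologies, finer means smaller, so this is an infimum. -/
@[reducible] def inductiveTopology {X : Type*} [AddCommGroup X] [Module ℂ X] {F : ℕ → Type*}
    [∀ n, AddCommGroup (F n)] [∀ n, Module ℂ (F n)] [∀ n, TopologicalSpace (F n)]
    (ι : ∀ n, F n →ₗ[ℂ] X) : TopologicalSpace X :=
  sInf {t : TopologicalSpace X |
    @IsTopologicalAddGroup X t _ ∧ @ContinuousSMul ℂ X _ _ t ∧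
      @LocallyConvexSpace ℝ X _ _ _ _ t ∧ ∀ n, @Continuous (F n) X _ t (ι n)}

/-- An inductive spectrum `F 0 ⊆ F 1 ⊆ ⋯` of (complex) Banach spaces with continuous inclusion
maps and union `X`. The space `F n` is identified with a linear subspace of `X` through the
injective linear map `ι n`. -/
structure BanachSpectrum.{u} (X : Type u) [AddCommGroup X] [Module ℂ X] where
  F : ℕ → Type u
  normedAddCommGroup : ∀ n, NormedAddCommGroup (F n)
  normedSpace : ∀ n, NormedSpace ℂ (F n)
  completeSpace : ∀ n, CompleteSpace (F n)
  /-- the embedding of the `n`-th step into `X` -/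
  ι : ∀ n, F n →ₗ[ℂ] X
  ι_injective : ∀ n, Function.Injective (ι n)
  /-- the (continuous) inclusion maps between the steps -/
  incl : ∀ {n m : ℕ}, n ≤ m → F n →L[ℂ] F m
  ι_incl : ∀ {n m : ℕ} (h : n ≤ m) (x : F n), ι m (incl h x) = ι n x
  exhausts : ∀ x : X, ∃ (n : ℕ) (y : F n), ι n y = x

attribute [instance] BanachSpectrum.normedAddCommGroup BanachSpectrum.normedSpace
  BanachSpectrum.completeSpace

/-- `X = Ind 𝒳`: the topology of `X` is the inductive limit topology of the spectrum. -/
def BanachSpectrum.IsInd {X : Type*} [AddCommGroup X] [Module ℂ X] [t : TopologicalSpace X]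
    (S : BanachSpectrum X) : Prop :=
  t = inductiveTopology S.ι

/-- `X` is an (LB)-space: a Hausdorff inductive limit of an inductive spectrum of Banach spaces. -/
def IsLB (X : Type*) [AddCommGroup X] [Module ℂ X] [TopologicalSpace X] : Prop :=
  T2Space X ∧ ∃ S : BanachSpectrum X, S.IsInd

/-- A nuclear map between Banach spaces: `T = ∑ⱼ φⱼ ⊗ yⱼ` with `∑ⱼ ‖φⱼ‖ ‖yⱼ‖ < ∞`. -/
def IsNuclearMap {F G : Type*} [NormedAddCommGroup F] [NormedSpace ℂ F] [NormedAddCommGroup G]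
    [NormedSpace ℂ G] (T : F →L[ℂ] G) : Prop :=
  ∃ (φ : ℕ → (F →L[ℂ] ℂ)) (y : ℕ → G),
    Summable (fun j => ‖φ j‖ * ‖y j‖) ∧ ∀ x : F, HasSum (fun j => φ j x • y j) (T x)

/-- `X` is an (LN)-space: a Hausdorff inductive limit of an inductive spectrum of Banach spaces
with nuclear inclusion maps `Xₙ → Xₙ₊₁`. -/
def IsLN (X : Type*) [AddCommGroup X] [Module ℂ X] [TopologicalSpace X] : Prop :=
  T2Space X ∧ ∃ S : BanachSpectrum X, S.IsInd ∧ ∀ n, IsNuclearMap (S.incl (Nat.le_succ n))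

/-! ### The sequence spaces `k^p(A)` -/

/-- The vector space of all `c ∈ ℂ^I` with `a c ∈ ℓ^p(I)`. -/
def weightedLpSubmodule {I : Type*} (p : ℝ≥0∞) (a : I → ℝ) : Submodule ℂ (I → ℂ) where
  carrier := {c | Memℓp (fun j => (a j : ℂ) * c j) p}
  add_mem' {c d} hc hd := by
    have h : (fun j => (a j : ℂ) * (c + d) j)
        = (fun j => (a j : ℂ) * c j) + (fun j => (a j : ℂ) * d j) := by
      funext j; simp [mul_add]
    simp only [mem_ofPred_eq, h]
    exact Memℓp.add hc hd
  zero_mem' := by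
    have h : (fun j => (a j : ℂ) * (0 : I → ℂ) j) = 0 := by funext j; simp
    simp only [mem_ofPred_eq, h]
    exact zero_memℓp
  smul_mem' s c hc := by
    have h : (fun j => (a j : ℂ) * (s • c) j) = s • (fun j => (a j : ℂ) * c j) := by
      funext j; simp [mul_left_comm]
    simp only [mem_ofPred_eq, h]
    exact Memℓp.const_smul hc s

/-- The space `ℓ^p(a)`. This is a type of its own, since it does not carry the topology of
coordinatewise convergence but that of the norm `‖c‖ = ‖a c‖_{ℓ^p}` defined below. -/
def WeightedLp {I : Type*} (p : ℝ≥0∞) (a : I → ℝ) : Type _ := ↥(weightedLpSubmodule p a)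

namespace WeightedLp

variable {I : Type*} (p : ℝ≥0∞) (a : I → ℝ)

instance : AddCommGroup (WeightedLp p a) := inferInstanceAs (AddCommGroup (weightedLpSubmodule p a))

instance : Module ℂ (WeightedLp p a) := inferInstanceAs (Module ℂ (weightedLpSubmodule p a))

/-- Multiplication by the weight, `c ↦ a c`, as a map `ℓ^p(a) → ℓ^p(I)`. -/
def mulWeight : WeightedLp p a →ₗ[ℂ] lp (fun _ : I => ℂ) p where
  toFun c := ⟨fun j => (a j : ℂ) * c.1 j, c.2⟩
  map_add' c d := by
    apply Subtype.ext; funext j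
    exact mul_add (a j : ℂ) (c.1 j) (d.1 j)
  map_smul' s c := by
    apply Subtype.ext; funext j
    exact mul_left_comm (a j : ℂ) s (c.1 j)

/-- The norm `‖c‖ = ‖a c‖_{ℓ^p}` (it is a norm if all weights are positive). -/
instance [Fact (1 ≤ p)] : SeminormedAddCommGroup (WeightedLp p a) :=
  SeminormedAddCommGroup.induced _ _ (mulWeight p a)

end WeightedLp

/-- The vector space `⋃ₙ ℓ^p(aₙ)` underlying `k^p(A)`; the spaces `ℓ^p(aₙ)` increase with `n` when
the weights `aₙ` decrease, and then their supremum is their union. -/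
def KSpace {I : Type*} (p : ℝ≥0∞) (a : ℕ → I → ℝ) : Type _ :=
  ↥(⨆ n, weightedLpSubmodule p (a n) : Submodule ℂ (I → ℂ))

namespace KSpace

variable {I : Type*} (p : ℝ≥0∞) (a : ℕ → I → ℝ)

instance : AddCommGroup (KSpace p a) :=
  inferInstanceAs (AddCommGroup (⨆ n, weightedLpSubmodule p (a n) : Submodule ℂ (I → ℂ)))

instance : Module ℂ (KSpace p a) :=
  inferInstanceAs (Module ℂ (⨆ n, weightedLpSubmodule p (a n) : Submodule ℂ (I → ℂ)))

/-- The inclusion map `ℓ^p(aₙ) → k^p(A)`. -/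
def ofStep (n : ℕ) : WeightedLp p (a n) →ₗ[ℂ] KSpace p a :=
  Submodule.inclusion (le_iSup (fun n => weightedLpSubmodule p (a n)) n)

/-- `k^p(A) = Ind (ℓ^p(aₙ))ₙ`. -/
instance [Fact (1 ≤ p)] : TopologicalSpace (KSpace p a) := inductiveTopology (ofStep p a)

end KSpace

/-- `E ≅ k^p(A)` for some index set `I` and some sequence `A = (aₙ)ₙ` of positive weights on `I`
with `aₙ₊₁ ≤ aₙ`. As `k^p(A)` contains the unit vectors, such an `I` embeds into `E`, so that
nothing is lost by taking `I` in the universe of `E`. -/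
def IsKSpace.{u} (p : ℝ≥0∞) [Fact (1 ≤ p)] (E : Type u) [AddCommGroup E] [Module ℂ E]
    [TopologicalSpace E] : Prop :=
  ∃ (I : Type u) (a : ℕ → I → ℝ), (∀ n j, 0 < a n j) ∧ (∀ n j, a (n + 1) j ≤ a n j) ∧
    Nonempty (E ≃L[ℂ] KSpace p a)

/-! ### Bounded sets, local completeness and the conditions (A) and (DΩ) -/

/-- `B` is a Banach disk: an absolutely convex bounded set such that the span of `B`, normed by
the Minkowski functional of `B`, is complete. -/
def IsBanachDisk {E : Type*} [AddCommGroup E] [Module ℂ E] [TopologicalSpace E] (B : Set E) :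
    Prop :=
  Balanced ℂ B ∧ Convex ℝ B ∧ IsVonNBounded ℂ B ∧
    ∀ u : ℕ → E, (∀ n, u n ∈ Submodule.span ℂ B) →
      (∀ ε > 0, ∃ N, ∀ m ≥ N, ∀ n ≥ N, gauge B (u m - u n) < ε) →
      ∃ x ∈ Submodule.span ℂ B, Tendsto (fun n => gauge B (u n - x)) atTop (𝓝 0)

/-- Every bounded set is contained in a Banach disk. -/
def IsLocallyComplete (E : Type*) [AddCommGroup E] [Module ℂ E] [TopologicalSpace E] : Prop :=
  ∀ D : Set E, IsVonNBounded ℂ D → ∃ B : Set E, IsBanachDisk B ∧ D ⊆ B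

/-- `(B_N)` is a fundamental sequence of bounded sets. -/
def IsFundamentalSeq {E : Type*} [AddCommGroup E] [Module ℂ E] [TopologicalSpace E]
    (B : ℕ → Set E) : Prop :=
  (∀ N, IsVonNBounded ℂ (B N)) ∧ ∀ D : Set E, IsVonNBounded ℂ D → ∃ N, D ⊆ B N

/-- Condition (A). It does not depend on the choice of the increasing fundamental sequence of
bounded sets. -/
def CondA (E : Type*) [AddCommGroup E] [Module ℂ E] [TopologicalSpace E] : Prop :=
  ∃ B : ℕ → Set E, Monotone B ∧ IsFundamentalSeq B ∧
    ∃ N, ∀ M ≥ N, ∀ ν : ℝ, 0 < ν → ∃ K ≥ M, ∃ C : ℝ, 0 < C ∧ ∀ r : ℝ, 0 < r →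
      B M ⊆ r • B K + (C / r ^ ν) • B N

/-- Condition (DΩ) for an inductive spectrum of Banach spaces. -/
def BanachSpectrum.CondDOmega {Z : Type*} [AddCommGroup Z] [Module ℂ Z] (S : BanachSpectrum Z) :
    Prop :=
  ∀ n, ∃ (m : ℕ) (hnm : n ≤ m), ∀ (k : ℕ) (hmk : m ≤ k), ∃ θ ∈ Ioo (0 : ℝ) 1, ∃ C : ℝ, 0 < C ∧
    ∀ z : S.F n, ‖S.incl hnm z‖ ≤ C * ‖z‖ ^ θ * ‖S.incl (hnm.trans hmk) z‖ ^ (1 - θ)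

/-- Condition (DΩ) for an (LB)-space `Z`. It does not depend on the choice of the spectrum, since
all inductive spectra of Banach spaces defining `Z` are equivalent. -/
def CondDOmega (Z : Type*) [AddCommGroup Z] [Module ℂ Z] [TopologicalSpace Z] : Prop :=
  ∃ S : BanachSpectrum Z, S.IsInd ∧ S.CondDOmega

/-! ### Weak `E`-acyclicity -/

/-- `Z` is weakly `E`-acyclic: for every exact sequence `0 → X → Y → Z → 0` of (LB)-spaces (with
continuous linear maps `ι`, `Q`), every continuous linear map `X → E` extends to `Y`. The universes
of `X` and `Y` are arbitrary. -/
def IsWeaklyAcyclic (E : Type uE) [AddCommGroup E] [Module ℂ E]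
    [TopologicalSpace E] (Z : Type uZ) [AddCommGroup Z] [Module ℂ Z] [TopologicalSpace Z] : Prop :=
  ∀ (X : Type uX) [AddCommGroup X] [Module ℂ X] [TopologicalSpace X]
    (Y : Type uY) [AddCommGroup Y] [Module ℂ Y] [TopologicalSpace Y],
    IsLB X → IsLB Y →
    ∀ (ι : X →L[ℂ] Y) (Q : Y →L[ℂ] Z),
      Function.Injective ι → Function.Exact ι Q → Function.Surjective Q →
      Function.Surjective (fun T : Y →L[ℂ] E => T.comp ι)

end

/-! Write `Y_n`, `Z_n`, `E_N` for the steps of the spectra, and regard `X` as the kernel of `Q`.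
Suppose each restriction of `T` to `X ∩ Y_n` extends to some `P_n : Y_n → E`. Two consecutive `P_n`
differ by an operator that kills `X`, so it descends to some `c_n` on a step of `Z`. If `c_n =
U_{n+1} - U_n` on that step, the operators `P_n - U_n ∘ Q` agree and glue to an extension of `T`
(`exists_extension_of_local`). Two things remain: local extension, and the vanishing of a derived
projective limit.

Local extension is where the four cases enter. If `E` has `ℓ^∞` steps or nuclear inclusions,
Hahn-Banach is applied to the coordinate functionals or to those of a nuclear representation. If `Z`
has `ℓ^1` steps or nuclear inclusions, the steps of `Z` lift through `Q`, and subtracting the lift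
maps `Y_n` into the kernel of `Q`.

The cochain is a coboundary by a Mittag-Leffler argument (`exists_coboundary`). It requires that
operators on `Z_m`, restricted to `Z_n`, be approximated by operators on any later `Z_k`
(`IsApproximable`). The errors take values in one fixed Banach space `E_N`, so that they can be
summed.

This density comes from balancing the two conditions. By Hahn-Banach, (DΩ) splits a functional on
`Z_m` into a part on `Z_n` of size `r ^ (-γ)` and a part on `Z_k` of size `r`. Condition (A) splits
a vector of `E_M` into a part in `E_K` of size `s` and a part in `E_N` of size `s ^ (-ν)`. The
exponent `γ` depends on `k`, which is why (A) is required for every `ν`. For `ℓ^1` or `ℓ^∞` steps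
the two splittings are matched coordinate by coordinate with `ν = γ`. For nuclear maps each
functional is decomposed dyadically, each term gets its own `s`, and `ν = γ / 4` makes both series
converge. A free factor `ρ` makes the `E_N` part as small as desired. -/

noncomputable section

/-! ### Grothendieck's factorization theorem. -/

section Factorization

variable {G : Type*} [NormedAddCommGroup G] [NormedSpace ℂ G] [CompleteSpace G]
  {F : ℕ → Type*} [∀ n, NormedAddCommGroup (F n)] [∀ n, NormedSpace ℂ (F n)]
  {Y : Type*} [AddCommGroup Y] [Module ℂ Y]

/-- The Baire category step of Grothendieck's factorization theorem. -/
theorem exists_approx_lift (f : G →ₗ[ℂ] Y) (κ : ∀ m, F m →ₗ[ℂ] Y)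
    (h : ∀ g, ∃ m y, κ m y = f g) :
    ∃ (m : ℕ) (C : ℝ), 0 < C ∧ ∀ g, ∃ g' y, κ m y = f g' ∧ ‖g - g'‖ ≤ ‖g‖ / 2 ∧
      ‖y‖ ≤ C * ‖g‖ := by
  let A : ℕ × ℕ → Set G := fun p => {g | ∃ y, κ p.1 y = f g ∧ ‖y‖ ≤ p.2}
  have hU : ⋃ p, closure (A p) = univ := by
    refine eq_univ_of_forall fun g => ?_
    obtain ⟨m, y, hy⟩ := h g
    obtain ⟨N, hN⟩ := exists_nat_ge ‖y‖
    exact mem_iUnion.2 ⟨(m, N), subset_closure ⟨y, hy, hN⟩⟩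
  obtain ⟨⟨m, N⟩, x, hx⟩ :=
    nonempty_interior_of_iUnion_of_closed (fun p => isClosed_closure (s := A p)) hU
  obtain ⟨ε, hε, hball⟩ := Metric.isOpen_iff.1 isOpen_interior x hx
  have hball' : Metric.ball x ε ⊆ closure (A (m, N)) := hball.trans interior_subset
  refine ⟨m, 4 * (N + 1) / ε, by positivity, fun g => ?_⟩
  rcases eq_or_ne g 0 with rfl | hg
  · exact ⟨0, 0, by simp⟩
  have hg0 : 0 < ‖g‖ := norm_pos_iff.2 hg
  -- `x` and `x + t g` both lie in the ball where lifts are dense. Approximating each within `ε / 8`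
  -- and subtracting gives an error `ε / 4`, which is half of `t ‖g‖`.
  set t : ℝ := ε / (2 * ‖g‖) with ht
  have ht0 : 0 < t := by positivity
  have htg : t * ‖g‖ = ε / 2 := by rw [ht]; field_simp
  have h1 : x + (t : ℂ) • g ∈ closure (A (m, N)) := hball' (by
    rw [Metric.mem_ball, dist_eq_norm, add_sub_cancel_left, norm_smul, Complex.norm_real,
      Real.norm_of_nonneg ht0.le, htg]
    linarith)
  have h2 : x ∈ closure (A (m, N)) := hball' (Metric.mem_ball_self hε)
  obtain ⟨a, ⟨ya, hya, hya'⟩, ha⟩ := Metric.mem_closure_iff.1 h1 (ε / 8) (by positivity)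
  obtain ⟨b, ⟨yb, hyb, hyb'⟩, hb⟩ := Metric.mem_closure_iff.1 h2 (ε / 8) (by positivity)
  rw [dist_eq_norm] at ha hb
  have htc : (t : ℂ) ≠ 0 := by exact_mod_cast ht0.ne'
  refine ⟨(t : ℂ)⁻¹ • (a - b), (t : ℂ)⁻¹ • (ya - yb), by simp [hya, hyb], ?_, ?_⟩
  · have : g - (t : ℂ)⁻¹ • (a - b) = (t : ℂ)⁻¹ • ((x + (t : ℂ) • g - a) - (x - b)) := by
      rw [show (x + (t : ℂ) • g - a) - (x - b) = (t : ℂ) • g - (a - b) by abel,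
        smul_sub _ ((t : ℂ) • g), smul_smul, inv_mul_cancel₀ htc, one_smul]
    rw [this, norm_smul, norm_inv, Complex.norm_real, Real.norm_of_nonneg ht0.le]
    have h3 := norm_sub_le (x + (t : ℂ) • g - a) (x - b)
    rw [inv_mul_le_iff₀ ht0]
    have : t * (‖g‖ / 2) = ε / 4 := by rw [← mul_div_assoc, htg]; ring
    linarith
  · rw [norm_smul, norm_inv, Complex.norm_real, Real.norm_of_nonneg ht0.le, inv_mul_le_iff₀ ht0]
    have h3 := norm_sub_le ya yb
    have : t * (4 * (N + 1) / ε * ‖g‖) = 2 * (N + 1) := by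
      rw [show t * (4 * (N + 1) / ε * ‖g‖) = (t * ‖g‖) * (4 * (N + 1) / ε) by ring, htg]
      field_simp; norm_num
    simp only at hya' hyb'
    linarith

variable [∀ n, CompleteSpace (F n)] [TopologicalSpace Y] [T2Space Y]

/-- Grothendieck's factorization theorem: if the range of a continuous linear map on a Banach space
is covered by the ranges of countably many continuous linear maps on Banach spaces, then one of
these suffices, with control of norms. -/
theorem exists_bounded_lift (f : G →ₗ[ℂ] Y) (hf : Continuous f) (κ : ∀ m, F m →ₗ[ℂ] Y)
    (hκ : ∀ m, Continuous (κ m)) (h : ∀ g, ∃ m y, κ m y = f g) :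
    ∃ (m : ℕ) (C : ℝ), 0 < C ∧ ∀ g, ∃ y, κ m y = f g ∧ ‖y‖ ≤ C * ‖g‖ := by
  obtain ⟨m, C, hC, H⟩ := exists_approx_lift f κ h
  choose a y hy ha hyC using H
  refine ⟨m, C * 2, by positivity, fun g => ?_⟩
  -- These are the residuals of successive approximation. Each is at most half the previous one, so
  -- the lifts of the corrections sum to an exact lift.
  let r : ℕ → G := fun n => (fun v => v - a v)^[n] g
  have hr1 : ∀ n, r (n + 1) = r n - a (r n) := fun n => Function.iterate_succ_apply' _ _ _
  have hr : ∀ n, ‖r n‖ ≤ ‖g‖ * (1 / 2) ^ n := by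
    intro n
    induction n with
    | zero => simp [r]
    | succ n ih =>
      rw [hr1]
      refine (ha _).trans ?_
      rw [pow_succ]
      linarith
  have hyn : ∀ n, ‖y (r n)‖ ≤ C * ‖g‖ * (1 / 2) ^ n := fun n =>
    (hyC _).trans (by rw [mul_assoc]; exact mul_le_mul_of_nonneg_left (hr n) hC.le)
  have hgeo : HasSum (fun n : ℕ => C * ‖g‖ * (1 / 2 : ℝ) ^ n) (C * ‖g‖ * 2) :=
    hasSum_geometric_two.mul_left _
  have hsum : Summable fun n => y (r n) := Summable.of_norm_bounded hgeo.summable hyn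
  refine ⟨∑' n, y (r n), ?_, ?_⟩
  · have h1 : Tendsto (fun n => κ m (∑ i ∈ Finset.range n, y (r i))) atTop
        (𝓝 (κ m (∑' n, y (r n)))) :=
      ((hκ m).tendsto _).comp hsum.hasSum.tendsto_sum_nat
    have h2 : ∀ n, κ m (∑ i ∈ Finset.range n, y (r i)) = f (g - r n) := by
      intro n
      induction n with
      | zero => simp [r]
      | succ n ih =>
        rw [Finset.sum_range_succ, map_add, ih, hy, hr1, ← map_add]
        congr 1; abel
    have h3 : Tendsto r atTop (𝓝 0) := by
      refine squeeze_zero_norm hr ?_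
      simpa using (tendsto_pow_atTop_nhds_zero_of_lt_one (r := (1 / 2 : ℝ)) (by norm_num)
        (by norm_num)).const_mul ‖g‖
    have h4 : Tendsto (fun n => f (g - r n)) atTop (𝓝 (f (g - 0))) :=
      (hf.tendsto _).comp (tendsto_const_nhds.sub h3)
    simp only [h2] at h1
    rw [sub_zero] at h4
    exact tendsto_nhds_unique h1 h4
  · refine (tsum_of_norm_bounded hgeo hyn).trans (le_of_eq (by ring))

/-- Grothendieck's factorization theorem for injective maps. -/
theorem exists_factorization (f : G →ₗ[ℂ] Y) (hf : Continuous f) (κ : ∀ m, F m →ₗ[ℂ] Y)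
    (hκ : ∀ m, Continuous (κ m)) (hinj : ∀ m, Function.Injective (κ m))
    (h : ∀ g, ∃ m y, κ m y = f g) :
    ∃ (m : ℕ) (f' : G →L[ℂ] F m), ∀ g, κ m (f' g) = f g := by
  obtain ⟨m, C, -, H⟩ := exists_bounded_lift f hf κ hκ h
  choose y hy hyC using H
  refine ⟨m, LinearMap.mkContinuous
    { toFun := y
      map_add' := fun u v => hinj m (by simp [hy])
      map_smul' := fun c u => hinj m (by simp [hy]) } C hyC, hy⟩

end Factorization

/-! ### Spectra with continuous embeddings. -/

namespace BanachSpectrum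

/-- The embeddings of the steps are continuous. -/
def IsContinuous {X : Type*} [AddCommGroup X] [Module ℂ X] [TopologicalSpace X]
    (S : BanachSpectrum X) : Prop :=
  ∀ n, Continuous (S.ι n)

section Algebra

variable {X : Type*} [AddCommGroup X] [Module ℂ X]

theorem incl_incl (S : BanachSpectrum X) {n m k : ℕ} (h : n ≤ m) (h' : m ≤ k) (x : S.F n) :
    S.incl h' (S.incl h x) = S.incl (h.trans h') x :=
  S.ι_injective k (by simp [S.ι_incl])

theorem incl_refl (S : BanachSpectrum X) {n : ℕ} (x : S.F n) : S.incl le_rfl x = x :=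
  S.ι_injective n (by simp [S.ι_incl])

theorem incl_injective (S : BanachSpectrum X) {n m : ℕ} (h : n ≤ m) :
    Function.Injective (S.incl h) := fun x y hxy =>
  S.ι_injective n (by rw [← S.ι_incl h, ← S.ι_incl h, hxy])

end Algebra

variable {X : Type*} [AddCommGroup X] [Module ℂ X] [TopologicalSpace X] {S : BanachSpectrum X}

/-- For `X`, `Z` and `E` this consequence is all that the proof uses; the universal property of the
inductive topology is needed only for `Y`. -/
theorem IsInd.isContinuous (h : S.IsInd) : S.IsContinuous := by
  intro n
  unfold IsInd at h
  rw [continuous_iff_coinduced_le, h]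
  exact le_sInf fun t ht => continuous_iff_coinduced_le.1 (ht.2.2.2 n)

/-- The embedding of a step as a continuous linear map. -/
def IsContinuous.ιL (h : S.IsContinuous) (n : ℕ) : S.F n →L[ℂ] X := ⟨S.ι n, h n⟩

@[simp]
theorem IsContinuous.ιL_apply (h : S.IsContinuous) (n : ℕ) (x : S.F n) : h.ιL n x = S.ι n x := rfl

theorem IsContinuous.exists_factorization [T2Space X] (h : S.IsContinuous) {G : Type*}
    [NormedAddCommGroup G] [NormedSpace ℂ G] [CompleteSpace G] (f : G →L[ℂ] X) :
    ∃ (m : ℕ) (f' : G →L[ℂ] S.F m), ∀ g, S.ι m (f' g) = f g :=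
  _root_.exists_factorization f.toLinearMap f.continuous S.ι h S.ι_injective fun _ => S.exhausts _

end BanachSpectrum

/-! ### Banach disks and the Banach spaces they span. -/

/-- A nonempty Banach disk. -/
structure BanachDisk (E : Type*) [AddCommGroup E] [Module ℂ E] [TopologicalSpace E] where
  carrier : Set E
  isBanachDisk : IsBanachDisk carrier
  nonempty : carrier.Nonempty

namespace BanachDisk

section Algebra

variable {E : Type*} [AddCommGroup E] [Module ℂ E] [TopologicalSpace E] (D : BanachDisk E)

theorem balanced : Balanced ℂ D.carrier := D.isBanachDisk.1

theorem convex : Convex ℝ D.carrier := D.isBanachDisk.2.1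

theorem isVonNBounded : IsVonNBounded ℂ D.carrier := D.isBanachDisk.2.2.1

theorem zero_mem : (0 : E) ∈ D.carrier := D.balanced.zero_mem D.nonempty

theorem exists_mem_smul {x : E} (hx : x ∈ Submodule.span ℂ D.carrier) :
    ∃ r : ℝ, 0 < r ∧ ∃ d ∈ D.carrier, x = r • d := by
  induction hx using Submodule.span_induction with
  | mem x hx => exact ⟨1, one_pos, x, hx, (one_smul _ _).symm⟩
  | zero => exact ⟨1, one_pos, 0, D.zero_mem, by simp⟩
  | add x y _ _ hx hy =>
    obtain ⟨r, hr, d, hd, rfl⟩ := hx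
    obtain ⟨s, hs, e, he, rfl⟩ := hy
    have : r • d + s • e ∈ (r + s) • D.carrier := by
      rw [D.convex.add_smul hr.le hs.le]
      exact add_mem_add (smul_mem_smul_set hd) (smul_mem_smul_set he)
    obtain ⟨f, hf, hf'⟩ := this
    exact ⟨r + s, by positivity, f, hf, hf'.symm⟩
  | smul c x _ hx =>
    obtain ⟨r, hr, d, hd, rfl⟩ := hx
    -- The `+ 1` keeps the factor positive when `c = 0`.
    refine ⟨(‖c‖ + 1) * r, by positivity, ((‖c‖ + 1 : ℝ) : ℂ)⁻¹ • c • d, ?_, ?_⟩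
    · rw [smul_smul]
      refine D.balanced.smul_mem ?_ hd
      rw [norm_mul, norm_inv, Complex.norm_real, Real.norm_of_nonneg (by positivity),
        inv_mul_le_iff₀ (by positivity)]
      linarith
    · have : ((‖c‖ + 1 : ℝ) : ℂ) ≠ 0 := by
        exact_mod_cast (by positivity : (‖c‖ + 1 : ℝ) ≠ 0)
      rw [← Complex.coe_smul, ← Complex.coe_smul, smul_smul, smul_smul, smul_smul,
        Complex.ofReal_mul]
      congr 1
      field_simp

/-- The disk as a subset of its span. -/
def unitSet : Set (Submodule.span ℂ D.carrier) := Subtype.val ⁻¹' D.carrier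

/-- A disk absorbs only its own span, while the general facts on gauges ask for absorbent sets. They
are applied to `unitSet` and brought back through this identity. -/
theorem gauge_unitSet (x : Submodule.span ℂ D.carrier) :
    gauge D.unitSet x = gauge D.carrier (x : E) := by
  rw [gauge_def', gauge_def']
  rfl

theorem unitSet_convex : Convex ℝ D.unitSet :=
  D.convex.linear_preimage ((Submodule.span ℂ D.carrier).subtype.restrictScalars ℝ)

theorem unitSet_absorbent : Absorbent ℝ D.unitSet := by
  intro x
  obtain ⟨r, hr, d, hd, hx⟩ := D.exists_mem_smul x.2
  rw [absorbs_iff_norm]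
  refine ⟨r, fun c hc => ?_⟩
  have hc0 : c ≠ 0 := norm_pos_iff.1 (hr.trans_le hc)
  rw [singleton_subset_iff, mem_smul_set_iff_inv_smul_mem₀ hc0]
  change c⁻¹ • (x : E) ∈ D.carrier
  rw [hx, smul_smul, ← Complex.coe_smul]
  refine D.balanced.smul_mem ?_ hd
  rw [Complex.norm_real, norm_mul, norm_inv, Real.norm_of_nonneg hr.le]
  rw [inv_mul_le_iff₀ (hr.trans_le hc)]
  linarith

theorem unitSet_isVonNBounded : IsVonNBounded ℝ D.unitSet := by
  intro V hV
  obtain ⟨U, hU, hUV⟩ := mem_nhds_induced Subtype.val (0 : Submodule.span ℂ D.carrier) V |>.1 hV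
  have h1 : Absorbs ℂ U D.carrier := D.isVonNBounded hU
  rw [absorbs_iff_norm] at h1 ⊢
  obtain ⟨r, hr⟩ := h1
  refine ⟨max r 1, fun c hc x hx => ?_⟩
  have hc0 : c ≠ 0 := norm_pos_iff.1 (lt_of_lt_of_le one_pos ((le_max_right _ _).trans hc))
  have h2 := hr c (by rw [Complex.norm_real]; exact (le_max_left _ _).trans hc) hx
  rw [mem_smul_set_iff_inv_smul_mem₀ (by exact_mod_cast hc0)] at h2
  rw [mem_smul_set_iff_inv_smul_mem₀ hc0]
  refine hUV ?_
  change c⁻¹ • (x : E) ∈ U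
  rwa [← Complex.coe_smul, Complex.ofReal_inv]

theorem gauge_add_le {x y : E} (hx : x ∈ Submodule.span ℂ D.carrier)
    (hy : y ∈ Submodule.span ℂ D.carrier) :
    gauge D.carrier (x + y) ≤ gauge D.carrier x + gauge D.carrier y := by
  have := _root_.gauge_add_le D.unitSet_convex D.unitSet_absorbent ⟨x, hx⟩ ⟨y, hy⟩
  rwa [gauge_unitSet, gauge_unitSet, gauge_unitSet] at this

theorem gauge_mono {D D' : BanachDisk E} (h : D.carrier ⊆ D'.carrier) {x : E}
    (hx : x ∈ Submodule.span ℂ D.carrier) : gauge D'.carrier x ≤ gauge D.carrier x := by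
  have := _root_.gauge_mono D.unitSet_absorbent
    (show D.unitSet ⊆ Submodule.inclusion (Submodule.span_mono h) ⁻¹' D'.unitSet from
      fun y hy => h hy) ⟨x, hx⟩
  rw [gauge_unitSet, gauge_def'] at this
  rw [gauge_def']
  exact this

theorem gauge_eq_zero [T2Space E] {x : E} (hx : x ∈ Submodule.span ℂ D.carrier) :
    gauge D.carrier x = 0 ↔ x = 0 := by
  have := _root_.gauge_eq_zero (x := ⟨x, hx⟩) D.unitSet_absorbent D.unitSet_isVonNBounded
  rwa [gauge_unitSet, Submodule.mk_eq_zero] at this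

/-- The span of a Banach disk, with the Minkowski functional as its norm. -/
def Span : Type _ := ↥(Submodule.span ℂ D.carrier)

instance : AddCommGroup D.Span := inferInstanceAs (AddCommGroup (Submodule.span ℂ D.carrier))

instance : Module ℂ D.Span := inferInstanceAs (Module ℂ (Submodule.span ℂ D.carrier))

/-- The embedding of the span of a Banach disk. -/
def incl : D.Span →ₗ[ℂ] E := (Submodule.span ℂ D.carrier).subtype

theorem incl_injective : Function.Injective D.incl := Subtype.val_injective

/-- An element of the span of a Banach disk. -/
def toSpan (x : E) (hx : x ∈ Submodule.span ℂ D.carrier) : D.Span := ⟨x, hx⟩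

@[simp]
theorem incl_toSpan (x : E) (hx : x ∈ Submodule.span ℂ D.carrier) : D.incl (D.toSpan x hx) = x := rfl

theorem incl_mem (x : D.Span) : D.incl x ∈ Submodule.span ℂ D.carrier := x.2

instance : Norm D.Span := ⟨fun x => gauge D.carrier (D.incl x)⟩

theorem norm_def (x : D.Span) : ‖x‖ = gauge D.carrier (D.incl x) := rfl

theorem norm_le_one {x : D.Span} (hx : D.incl x ∈ D.carrier) : ‖x‖ ≤ 1 := gauge_le_one_of_mem hx

end Algebra

section Normed

variable {E : Type*} [AddCommGroup E] [Module ℂ E] [TopologicalSpace E] [T2Space E]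
  (D : BanachDisk E)

theorem core : NormedSpace.Core ℂ D.Span where
  norm_nonneg x := gauge_nonneg _
  norm_smul c x := by
    rw [norm_def, norm_def, map_smul, gauge_smul D.balanced]
  norm_triangle x y := by
    rw [norm_def, norm_def, norm_def, map_add]
    exact D.gauge_add_le (D.incl_mem x) (D.incl_mem y)
  norm_eq_zero_iff x := by
    rw [norm_def, D.gauge_eq_zero (D.incl_mem x), map_eq_zero_iff _ D.incl_injective]

instance : NormedAddCommGroup D.Span := NormedAddCommGroup.ofCore D.core

instance : NormedSpace ℂ D.Span := NormedSpace.ofCore D.core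

instance : CompleteSpace D.Span := by
  refine Metric.complete_of_cauchySeq_tendsto fun u hu => ?_
  rw [Metric.cauchySeq_iff] at hu
  obtain ⟨x, hx, hux⟩ := D.isBanachDisk.2.2.2 (fun n => D.incl (u n)) (fun n => (u n).2) (by
    intro ε hε
    obtain ⟨N, hN⟩ := hu ε hε
    refine ⟨N, fun m hm n hn => ?_⟩
    have := hN m hm n hn
    rwa [dist_eq_norm, norm_def, map_sub] at this)
  refine ⟨D.toSpan x hx, ?_⟩
  rw [tendsto_iff_norm_sub_tendsto_zero]
  exact hux

/-- Every neighbourhood of zero absorbs the bounded disk, so the gauge topology is finer than the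
induced one. -/
theorem continuous_incl [IsTopologicalAddGroup E] : Continuous D.incl := by
  refine continuous_of_continuousAt_zero D.incl ?_
  have h := comap_gauge_nhds_zero_le D.unitSet_absorbent D.unitSet_isVonNBounded
  let e : D.Span → Submodule.span ℂ D.carrier := fun x => ⟨D.incl x, D.incl_mem x⟩
  have h1 : Tendsto (fun x : D.Span => gauge D.unitSet (e x)) (𝓝 0) (𝓝 0) := by
    simp only [gauge_unitSet]
    exact tendsto_norm_zero (E := D.Span)
  have h2 : Tendsto e (𝓝 0) (𝓝 0) := Tendsto.mono_right (tendsto_comap_iff (g := gauge D.unitSet).2 h1) h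
  rw [ContinuousAt, map_zero]
  exact ((continuous_subtype_val (p := (· ∈ Submodule.span ℂ D.carrier))).tendsto _).comp h2

/-- The inclusion between the spans of two Banach disks. -/
def inclusion {D D' : BanachDisk E} (h : D.carrier ⊆ D'.carrier) : D.Span →L[ℂ] D'.Span :=
  LinearMap.mkContinuous
    { toFun := fun x => D'.toSpan (D.incl x) (Submodule.span_mono h (D.incl_mem x))
      map_add' := fun x y => rfl
      map_smul' := fun c x => rfl } 1 fun x => by
    rw [one_mul, norm_def, norm_def]
    exact gauge_mono h (D.incl_mem x)

end Normed

end BanachDisk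

/-! ### Spectra obtained from local completeness. -/

section LocallyComplete

variable {E : Type uE} [AddCommGroup E] [Module ℂ E] [TopologicalSpace E]

theorem IsLocallyComplete.exists_banachDisk [ContinuousSMul ℂ E] (hE : IsLocallyComplete E)
    {B : Set E} (hB : IsVonNBounded ℂ B) : ∃ D : BanachDisk E, B ⊆ D.carrier := by
  obtain ⟨D, hD, hBD⟩ := hE (insert 0 B) (hB.insert 0)
  exact ⟨⟨D, hD, 0, hBD (mem_insert _ _)⟩, (subset_insert _ _).trans hBD⟩

variable [T2Space E]

/-- An increasing sequence of Banach disks whose spans cover the space defines a spectrum. -/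
def BanachSpectrum.ofDisks (D : ℕ → BanachDisk E) (hD : Monotone fun n => (D n).carrier)
    (h : ∀ x, ∃ n, x ∈ (D n).carrier) : BanachSpectrum E where
  F n := (D n).Span
  normedAddCommGroup n := inferInstance
  normedSpace n := inferInstance
  completeSpace n := inferInstance
  ι n := (D n).incl
  ι_injective n := (D n).incl_injective
  incl h := BanachDisk.inclusion (hD h)
  ι_incl h x := rfl
  exhausts x := by
    obtain ⟨n, hn⟩ := h x
    exact ⟨n, (D n).toSpan x (Submodule.subset_span hn), rfl⟩

/-- No claim is made that `E` carries the inductive topology of this spectrum; continuous embeddings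
suffice for the target space. -/
theorem IsLocallyComplete.exists_spectrum [IsTopologicalAddGroup E] [ContinuousSMul ℂ E]
    (hE : IsLocallyComplete E) {B : ℕ → Set E} (hB : IsFundamentalSeq B) :
    ∃ S : BanachSpectrum E, S.IsContinuous := by
  have H : ∀ s : {s : Set E // IsVonNBounded ℂ s}, ∃ D : BanachDisk E, s.1 ⊆ D.carrier :=
    fun s => hE.exists_banachDisk s.2
  choose Φ hΦ using H
  -- Each disk is chosen to contain the previous one as well as the next `B`; this makes the
  -- sequence increase.
  let D : ℕ → BanachDisk E := fun n => Nat.rec (Φ ⟨B 0, hB.1 0⟩)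
    (fun n D => Φ ⟨D.carrier ∪ B (n + 1), D.isVonNBounded.union (hB.1 (n + 1))⟩) n
  have hD : ∀ n, D (n + 1) =
      Φ ⟨(D n).carrier ∪ B (n + 1), (D n).isVonNBounded.union (hB.1 (n + 1))⟩ := fun n => rfl
  have hmono : Monotone fun n => (D n).carrier := monotone_nat_of_le_succ fun n => by
    rw [hD]
    exact subset_union_left.trans (hΦ ⟨_, (D n).isVonNBounded.union (hB.1 (n + 1))⟩)
  have hBD : ∀ n, B n ⊆ (D n).carrier := by
    rintro (_ | n)
    · exact hΦ ⟨B 0, hB.1 0⟩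
    · rw [hD]
      exact subset_union_right.trans (hΦ ⟨_, (D n).isVonNBounded.union (hB.1 (n + 1))⟩)
  refine ⟨BanachSpectrum.ofDisks D hmono fun x => ?_, fun n => (D n).continuous_incl⟩
  obtain ⟨n, hn⟩ := hB.2 {x} (isVonNBounded_singleton x)
  exact ⟨n, hBD n (hn rfl)⟩

/-- The span of a Banach disk around `B` is a Banach space, so Grothendieck factorization puts it
into a single step. Balls of the steps thus serve as a fundamental system of bounded sets, whatever
the spectrum. -/
theorem BanachSpectrum.IsContinuous.subset_image_ball [IsTopologicalAddGroup E]
    [ContinuousSMul ℂ E] {S : BanachSpectrum E} (hS : S.IsContinuous) (hE : IsLocallyComplete E)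
    {B : Set E} (hB : IsVonNBounded ℂ B) :
    ∃ (m : ℕ) (C : ℝ), 0 < C ∧ ∀ x ∈ B, ∃ y, S.ι m y = x ∧ ‖y‖ ≤ C := by
  obtain ⟨D, hD⟩ := hE.exists_banachDisk hB
  obtain ⟨m, C, hC, h⟩ := exists_bounded_lift D.incl D.continuous_incl S.ι hS
    fun g => S.exhausts _
  refine ⟨m, C, hC, fun x hx => ?_⟩
  obtain ⟨y, hy, hyC⟩ := h (D.toSpan x (Submodule.subset_span (hD hx)))
  refine ⟨y, hy, hyC.trans ?_⟩
  exact mul_le_of_le_one_right hC.le (D.norm_le_one (hD hx))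

end LocallyComplete

/-! ### Conditions (A) and (DΩ) for a given spectrum. -/

namespace BanachSpectrum

/-- Condition (A) in terms of a spectrum of Banach spaces. -/
def CondA {E : Type*} [AddCommGroup E] [Module ℂ E] (S : BanachSpectrum E) (N : ℕ) : Prop :=
  ∀ M, N ≤ M → ∀ ν : ℝ, 0 < ν → ∃ K, M ≤ K ∧ ∃ C : ℝ, 0 < C ∧ ∀ r : ℝ, 0 < r → ∀ x : S.F M,
    ∃ (y : S.F K) (z : S.F N), S.ι M x = S.ι K y + S.ι N z ∧ ‖y‖ ≤ r * ‖x‖ ∧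
      ‖z‖ ≤ C / r ^ ν * ‖x‖

theorem IsContinuous.condA {E : Type*} [AddCommGroup E] [Module ℂ E] [TopologicalSpace E]
    [T2Space E] [IsTopologicalAddGroup E] [ContinuousSMul ℂ E] {S : BanachSpectrum E}
    (hS : S.IsContinuous) (hE : IsLocallyComplete E) (hA : _root_.CondA E) :
    ∃ N, S.CondA N := by
  obtain ⟨B, hmono, hB, N₀, hN₀⟩ := hA
  obtain ⟨N, l, hl, hN⟩ := hS.subset_image_ball hE (hB.1 N₀)
  refine ⟨N, fun M hNM ν hν => ?_⟩
  obtain ⟨M₀, hM₀⟩ := hB.2 _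
    ((NormedSpace.isVonNBounded_closedBall ℂ (S.F M) 1).image (hS.ιL M))
  obtain ⟨K₀, hK₀, C, hC, H⟩ := hN₀ (max M₀ N₀) (le_max_right _ _) ν hν
  obtain ⟨K₁, μ, hμ, hK₁⟩ := hS.subset_image_ball hE (hB.1 K₀)
  refine ⟨max K₁ M, le_max_right _ _, ?_⟩
  -- `c` bounds the elements of `B K₀` in the norm of the final step. Using (A) with `r / c`
  -- compensates for it, at the price of the factor `c ^ ν`.
  set c : ℝ := ‖S.incl (le_max_left K₁ M)‖ * μ + 1 with hc
  have hc0 : 0 < c := by positivity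
  refine ⟨C * c ^ ν * l, by positivity, fun r hr x => ?_⟩
  rcases eq_or_ne x 0 with rfl | hx
  · exact ⟨0, 0, by simp⟩
  have hx0 : 0 < ‖x‖ := norm_pos_iff.2 hx
  have hxc : (‖x‖ : ℂ) ≠ 0 := by exact_mod_cast hx0.ne'
  have h1 : S.ι M ((‖x‖ : ℂ)⁻¹ • x) ∈ B (max M₀ N₀) := hmono (le_max_left _ _) (hM₀
    ⟨_, by simp [norm_smul, hx0.ne'], rfl⟩)
  obtain ⟨_, ⟨b, hb, rfl⟩, _, ⟨d, hd, rfl⟩, hbd⟩ := H (r / c) (by positivity) h1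
  obtain ⟨y, rfl, hy⟩ := hK₁ b hb
  obtain ⟨z, rfl, hz⟩ := hN d hd
  have hrν : (r / c) ^ ν = r ^ ν / c ^ ν := Real.div_rpow hr.le hc0.le ν
  refine ⟨(‖x‖ : ℂ) • ((r / c : ℝ) : ℂ) • S.incl (le_max_left K₁ M) y,
    (‖x‖ : ℂ) • ((C / (r / c) ^ ν : ℝ) : ℂ) • z, ?_, ?_, ?_⟩
  · have h2 : S.ι M x = (‖x‖ : ℂ) • S.ι M ((‖x‖ : ℂ)⁻¹ • x) := by
      rw [map_smul, smul_smul, mul_inv_cancel₀ hxc, one_smul]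
    rw [h2, ← hbd]
    simp only [map_smul, S.ι_incl, smul_add]
    rfl
  · rw [norm_smul, norm_smul, Complex.norm_real, Complex.norm_real, norm_norm,
      Real.norm_of_nonneg (by positivity), mul_comm r]
    refine mul_le_mul_of_nonneg_left ?_ hx0.le
    have h3 : ‖S.incl (le_max_left K₁ M) y‖ ≤ c := by
      refine (ContinuousLinearMap.le_opNorm _ _).trans ?_
      have := mul_le_mul_of_nonneg_left hy (norm_nonneg (S.incl (le_max_left K₁ M)))
      linarith
    calc r / c * ‖S.incl (le_max_left K₁ M) y‖ ≤ r / c * c := by gcongr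
      _ = r := by field_simp
  · rw [norm_smul, norm_smul, Complex.norm_real, Complex.norm_real, norm_norm,
      Real.norm_of_nonneg (by positivity), mul_comm _ ‖x‖]
    refine mul_le_mul_of_nonneg_left ?_ hx0.le
    have : C * c ^ ν * l / r ^ ν = C / (r / c) ^ ν * l := by
      rw [hrν]; field_simp
    rw [this]
    gcongr

/-- By factorization the two spectra are interleaved, and the inequality is transported with the
same `θ`. The `+ 1` in the constant only ensures positivity, as the operator norms may vanish. -/
theorem IsContinuous.condDOmega {Z : Type*} [AddCommGroup Z] [Module ℂ Z] [TopologicalSpace Z]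
    [T2Space Z] {S S' : BanachSpectrum Z} (hS : S.IsContinuous) (hS' : S'.IsContinuous)
    (h : S.CondDOmega) : S'.CondDOmega := by
  intro n
  obtain ⟨a, j, hj⟩ := hS.exists_factorization (hS'.ιL n)
  obtain ⟨m₀, ham, hm₀⟩ := h a
  obtain ⟨m₁, j₁, hj₁⟩ := hS'.exists_factorization (hS.ιL m₀)
  refine ⟨max m₁ n, le_max_right _ _, fun k hk => ?_⟩
  obtain ⟨k₁, j₂, hj₂⟩ := hS.exists_factorization (hS'.ιL k)
  obtain ⟨θ, hθ, C, hC, H⟩ := hm₀ (max k₁ m₀) (le_max_right _ _)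
  have hθ' : 0 < 1 - θ := sub_pos.2 hθ.2
  let A := ‖(S'.incl (le_max_left m₁ n)).comp j₁‖
  let D := ‖(S.incl (le_max_left k₁ m₀)).comp j₂‖
  refine ⟨θ, hθ, A * C * ‖j‖ ^ θ * D ^ (1 - θ) + 1, by positivity, fun z => ?_⟩
  have e1 : S'.incl (le_max_right m₁ n) z =
      (S'.incl (le_max_left m₁ n)).comp j₁ (S.incl ham (j z)) := by
    apply S'.ι_injective
    simp [S'.ι_incl, S.ι_incl, hj₁, hj]
  have e2 : S.incl (ham.trans (le_max_right k₁ m₀)) (j z) =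
      (S.incl (le_max_left k₁ m₀)).comp j₂ (S'.incl ((le_max_right m₁ n).trans hk) z) := by
    apply S.ι_injective
    simp [S'.ι_incl, S.ι_incl, hj₂, hj]
  set w := ‖S'.incl ((le_max_right m₁ n).trans hk) z‖
  calc ‖S'.incl (le_max_right m₁ n) z‖ ≤ A * ‖S.incl ham (j z)‖ := by
        rw [e1]; exact ContinuousLinearMap.le_opNorm _ _
    _ ≤ A * (C * ‖j z‖ ^ θ * ‖S.incl (ham.trans (le_max_right k₁ m₀)) (j z)‖ ^ (1 - θ)) := by
        gcongr; exact H _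
    _ ≤ A * (C * (‖j‖ * ‖z‖) ^ θ * (D * w) ^ (1 - θ)) := by
        gcongr
        · exact hθ.1.le
        · exact j.le_opNorm z
        · rw [e2]; exact ContinuousLinearMap.le_opNorm _ _
    _ = A * C * ‖j‖ ^ θ * D ^ (1 - θ) * ‖z‖ ^ θ * w ^ (1 - θ) := by
        rw [Real.mul_rpow (by positivity) (by positivity),
          Real.mul_rpow (by positivity) (by positivity)]
        ring
    _ ≤ _ := by
        gcongr
        linarith

end BanachSpectrum

/-! ### The Mittag-Leffler argument. -/

namespace BanachSpectrum

section MittagLeffler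

variable {Z : Type*} [AddCommGroup Z] [Module ℂ Z]
  {E : Type*} [AddCommGroup E] [Module ℂ E] [TopologicalSpace E]

/-- Operators on the step `m` restricted to the step `n` can be approximated by operators on the
step `k`, up to small operators with values in the `N`-th step of `R`. -/
def Approximates (S : BanachSpectrum Z) (R : BanachSpectrum E) (N : ℕ) {n m k : ℕ}
    (hnm : n ≤ m) (hmk : m ≤ k) : Prop :=
  ∀ (A : S.F m →L[ℂ] E) (ε : ℝ), 0 < ε → ∃ (U : S.F k →L[ℂ] E) (V : S.F n →L[ℂ] R.F N),
    ‖V‖ ≤ ε ∧ ∀ z, A (S.incl hnm z) = U (S.incl (hnm.trans hmk) z) + R.ι N (V z)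

theorem Approximates.mono {S : BanachSpectrum Z} {R : BanachSpectrum E} {N n m m' k : ℕ}
    {hnm : n ≤ m} (hmm' : m ≤ m') (hmk : m' ≤ k)
    (h : S.Approximates R N hnm (hmm'.trans hmk)) :
    S.Approximates R N (hnm.trans hmm') hmk := by
  intro A ε hε
  obtain ⟨U, V, hV, hUV⟩ := h (A.comp (S.incl hmm')) ε hε
  refine ⟨U, V, hV, fun z => ?_⟩
  rw [← hUV z, ContinuousLinearMap.comp_apply, incl_incl]

/-- The density condition of Mittag-Leffler type. -/
def IsApproximable (S : BanachSpectrum Z) (R : BanachSpectrum E) (N : ℕ) : Prop :=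
  ∀ n, ∃ (m : ℕ) (hnm : n ≤ m), ∀ (k : ℕ) (hmk : m ≤ k), S.Approximates R N hnm hmk

theorem IsApproximable.exists_subsequence {S : BanachSpectrum Z} {R : BanachSpectrum E} {N : ℕ}
    (h : S.IsApproximable R N) : ∃ (φ : ℕ → ℕ) (hφ : StrictMono φ), ∀ i,
      S.Approximates R N (hφ.monotone (Nat.le_succ i)) (hφ.monotone (Nat.le_succ (i + 1))) := by
  choose m hnm hm using h
  -- `m n = n` is allowed, so the `+ 1` is what makes the subsequence strictly increasing.
  let φ : ℕ → ℕ := fun i => Nat.rec 0 (fun _ n => m n + 1) i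
  have hφ1 : ∀ i, φ (i + 1) = m (φ i) + 1 := fun i => rfl
  have hφ : StrictMono φ := strictMono_nat_of_lt_succ fun i => by
    rw [hφ1]; exact Nat.lt_succ_of_le (hnm _)
  exact ⟨φ, hφ, fun i => Approximates.mono (Nat.le_succ _) (hφ.monotone (Nat.le_succ (i + 1)))
    (hm (φ i) _ _)⟩

variable [IsTopologicalAddGroup E]

/-- The Mittag-Leffler argument: every cochain is a coboundary. -/
theorem exists_coboundary {S : BanachSpectrum Z} {R : BanachSpectrum E} (hR : R.IsContinuous)
    {N : ℕ} {φ : ℕ → ℕ} (hφ : Monotone φ)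
    (h : ∀ i, S.Approximates R N (hφ (Nat.le_succ i)) (hφ (Nat.le_succ (i + 1))))
    (c : ∀ i, S.F (φ i) →L[ℂ] E) :
    ∃ U : ∀ i, S.F (φ i) →L[ℂ] E, ∀ i z,
      c i z = U (i + 1) (S.incl (hφ (Nat.le_succ i)) z) - U i z := by
  -- Dividing by all norms of inclusions into step `φ j` makes the `j`-th error at most `2 ^ (-j)`
  -- when restricted to any earlier step.
  let ε : ℕ → ℝ := fun j =>
    (1 / 2) ^ j / (1 + ∑ i ∈ Finset.range (j + 1), if hij : i ≤ j then ‖S.incl (hφ hij)‖ else 0)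
  have hpos : ∀ j, 0 ≤ ∑ i ∈ Finset.range (j + 1),
      (if hij : i ≤ j then ‖S.incl (hφ hij)‖ else 0) := fun j =>
    Finset.sum_nonneg fun i _ => by split_ifs <;> positivity
  have hε : ∀ j, 0 < ε j := fun j => by
    have := hpos j
    simp only [ε]
    positivity
  have hεincl : ∀ i j (hij : i ≤ j), ε j * ‖S.incl (hφ hij)‖ ≤ (1 / 2) ^ j := by
    intro i j hij
    have h1 : ‖S.incl (hφ hij)‖ ≤ ∑ i ∈ Finset.range (j + 1),
        (if hij : i ≤ j then ‖S.incl (hφ hij)‖ else 0) := by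
      have := Finset.single_le_sum (f := fun i => if hij : i ≤ j then ‖S.incl (hφ hij)‖ else 0)
        (fun i _ => by split_ifs <;> positivity) (Finset.mem_range.2 (Nat.lt_succ_of_le hij))
      simpa [hij] using this
    have h2 := hpos j
    simp only [ε]
    rw [div_mul_eq_mul_div, div_le_iff₀ (by positivity)]
    gcongr
    linarith
  choose U V hV hUV using fun i (A : S.F (φ (i + 1)) →L[ℂ] E) => h i A (ε i) (hε i)
  -- On step `φ i`, `c (i + 1) + g i = g (i + 1) + s i`, where `s i` is small with values in the
  -- fixed step `N` of `R`.
  let g : ∀ i, S.F (φ (i + 1)) →L[ℂ] E := fun i => Nat.rec 0 (fun i g => U i (c (i + 1) + g)) i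
  have hg : ∀ i, g (i + 1) = U i (c (i + 1) + g i) := fun i => rfl
  let s : ∀ i, S.F (φ i) →L[ℂ] R.F N := fun i => V i (c (i + 1) + g i)
  let t : ∀ i, ℕ → (S.F (φ i) →L[ℂ] R.F N) := fun i j =>
    if hij : i ≤ j then (s j).comp (S.incl (hφ hij)) else 0
  have ht : ∀ i, Summable (t i) := fun i => by
    refine Summable.of_norm_bounded (g := fun j => (1 / 2 : ℝ) ^ j) summable_geometric_two
      fun j => ?_
    by_cases hij : i ≤ j
    · simp only [t, hij, dif_pos]
      refine (ContinuousLinearMap.opNorm_comp_le _ _).trans (le_trans ?_ (hεincl i j hij))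
      gcongr
      exact hV _ _
    · simp only [t, hij, dif_neg, not_false_iff, norm_zero]
      positivity
  -- The tail of the error series on step `φ i`; consecutive tails differ by `s i`, so subtracting
  -- them removes the errors.
  let W : ∀ i, S.F (φ i) →L[ℂ] R.F N := fun i => ∑' j, t i j
  have hW : ∀ i z, W i z - W (i + 1) (S.incl (hφ (Nat.le_succ i)) z) = s i z := by
    intro i z
    have h1 : HasSum (fun j => t i j z) (W i z) :=
      (ht i).hasSum.mapL (ContinuousLinearMap.apply ℂ (R.F N) z)
    have h2 : HasSum (fun j => t (i + 1) j (S.incl (hφ (Nat.le_succ i)) z))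
        (W (i + 1) (S.incl (hφ (Nat.le_succ i)) z)) :=
      (ht (i + 1)).hasSum.mapL (ContinuousLinearMap.apply ℂ (R.F N) _)
    refine (h1.sub h2).unique ?_
    convert hasSum_single i ?_ using 1
    · simp [t, incl_refl]
    · intro j hj
      rcases lt_or_gt_of_ne hj with hj | hj
      · simp [t, not_le.2 hj, not_le.2 (hj.trans (Nat.lt_succ_self i))]
      · simp [t, hj.le, Nat.succ_le_of_lt hj, incl_incl]
  refine ⟨fun i => (g i).comp (S.incl (hφ (Nat.le_succ i))) - (hR.ιL N).comp (W i) - c i,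
    fun i z => ?_⟩
  have h1 := hUV i (c (i + 1) + g i) z
  rw [← hg] at h1
  have h2 := congrArg (R.ι N) (hW i z)
  simp only [map_sub] at h2
  simp only [sub_apply, ContinuousLinearMap.comp_apply,
    IsContinuous.ιL_apply, add_apply] at h1 ⊢
  rw [← h2, ← incl_incl S (hφ (Nat.le_succ i)) (hφ (Nat.le_succ (i + 1)))] at h1
  linear_combination (norm := module) h1

end MittagLeffler

end BanachSpectrum

/-! ### Gluing local extensions. -/

/-- Compatible linear maps on a covering sequence of spaces can be glued. -/
theorem exists_glued_linearMap {Y E : Type*} [AddCommGroup Y] [Module ℂ Y] [AddCommGroup E]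
    [Module ℂ E] {W : ℕ → Type*} [∀ i, AddCommGroup (W i)] [∀ i, Module ℂ (W i)]
    (κ : ∀ i, W i →ₗ[ℂ] Y) (A : ∀ i, W i →ₗ[ℂ] E)
    (hstep : ∀ i w, ∃ w', κ (i + 1) w' = κ i w ∧ A (i + 1) w' = A i w)
    (hker : ∀ i w, κ i w = 0 → A i w = 0) (hex : ∀ y, ∃ i w, κ i w = y) :
    ∃ T : Y →ₗ[ℂ] E, ∀ i w, T (κ i w) = A i w := by
  have hle : ∀ i j, i ≤ j → ∀ w, ∃ w', κ j w' = κ i w ∧ A j w' = A i w := by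
    intro i j hij
    induction j, hij using Nat.le_induction with
    | base => exact fun w => ⟨w, rfl, rfl⟩
    | succ j _ ih =>
      intro w
      obtain ⟨w', h1, h2⟩ := ih w
      obtain ⟨w'', h3, h4⟩ := hstep j w'
      exact ⟨w'', h3.trans h1, h4.trans h2⟩
  have huniq : ∀ i j w w', κ i w = κ j w' → A i w = A j w' := by
    intro i j w w' h
    obtain ⟨v, hv, hv'⟩ := hle i (max i j) (le_max_left _ _) w
    obtain ⟨u, hu, hu'⟩ := hle j (max i j) (le_max_right _ _) w'
    rw [← hv', ← hu', ← sub_eq_zero, ← map_sub]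
    exact hker _ _ (by rw [map_sub, hv, hu, h, sub_self])
  choose i w hw using hex
  refine ⟨{ toFun := fun y => A (i y) (w y), map_add' := fun x y => ?_,
            map_smul' := fun c x => ?_ }, fun j v => huniq _ _ _ _ (hw _)⟩
  · obtain ⟨v, hv, hv'⟩ := hle (i x) (max (i x) (i y)) (le_max_left _ _) (w x)
    obtain ⟨u, hu, hu'⟩ := hle (i y) (max (i x) (i y)) (le_max_right _ _) (w y)
    rw [← hv', ← hu', ← map_add]
    exact huniq _ _ _ _ (by rw [hw, map_add, hv, hu, hw, hw])
  · rw [RingHom.id_apply, ← map_smul]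
    exact huniq _ _ _ _ (by rw [hw, map_smul, hw])

/-- A linear map is continuous on an inductive limit if it is continuous on the steps. -/
theorem BanachSpectrum.IsInd.continuous {Y E : Type*} [AddCommGroup Y] [Module ℂ Y]
    [TopologicalSpace Y] {S : BanachSpectrum Y} (hS : S.IsInd) [AddCommGroup E] [Module ℂ E]
    [TopologicalSpace E] [IsTopologicalAddGroup E] [ContinuousSMul ℂ E] [LocallyConvexSpace ℝ E]
    (T : Y →ₗ[ℂ] E) (hT : ∀ n, Continuous fun x => T (S.ι n x)) : Continuous T := by
  rw [continuous_iff_le_induced]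
  refine (le_of_eq hS).trans (sInf_le ⟨?_, ?_, ?_, fun n => ?_⟩)
  · exact topologicalAddGroup_induced T
  · exact continuousSMul_induced T
  · exact LocallyConvexSpace.induced (T.restrictScalars ℝ)
  · exact continuous_induced_rng.2 (hT n)

/-- A continuous linear map that vanishes on the kernel of `q` descends along bounded lifts. -/
theorem exists_descended_map {G H Z E : Type*} [NormedAddCommGroup G] [NormedSpace ℂ G]
    [CompleteSpace G] [NormedAddCommGroup H] [NormedSpace ℂ H] [AddCommGroup Z] [Module ℂ Z]
    [AddCommGroup E] [Module ℂ E] [TopologicalSpace E] [T2Space E] {R : BanachSpectrum E}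
    (hR : R.IsContinuous) (q : G →ₗ[ℂ] Z) (j : H →ₗ[ℂ] Z) (C : ℝ)
    (hlift : ∀ z, ∃ y, q y = j z ∧ ‖y‖ ≤ C * ‖z‖) (A : G →L[ℂ] E) (hA : ∀ y, q y = 0 → A y = 0) :
    ∃ c : H →L[ℂ] E, ∀ z y, q y = j z → c z = A y := by
  -- With values in one Banach step, continuity becomes a norm bound. The chosen lift `l` need not
  -- be linear, but `A' ∘ l` is, because `A'` vanishes on the kernel of `q`.
  obtain ⟨m, A', hA'⟩ := hR.exists_factorization A
  choose l hl hlC using hlift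
  have hq : ∀ y y', q y = q y' → A' y = A' y' := fun y y' h => by
    apply R.ι_injective
    rw [hA', hA', ← sub_eq_zero, ← map_sub]
    exact hA _ (by rw [map_sub, h, sub_self])
  let c : H →L[ℂ] R.F m := LinearMap.mkContinuous
    { toFun := fun z => A' (l z)
      map_add' := fun x y => by
        rw [← map_add]; exact hq _ _ (by simp [hl])
      map_smul' := fun a x => by
        rw [RingHom.id_apply, ← map_smul]; exact hq _ _ (by simp [hl]) } (‖A'‖ * C) fun z => by
    refine (A'.le_opNorm _).trans ?_
    rw [mul_assoc]
    exact mul_le_mul_of_nonneg_left (hlC z) (norm_nonneg _)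
  refine ⟨(hR.ιL m).comp c, fun z y h => ?_⟩
  rw [← hA']
  exact congrArg (R.ι m) (hq _ _ (by rw [hl, h]))

/-- If the spectra of `Z` and `E` satisfy the Mittag-Leffler condition, a continuous linear map
that extends locally extends globally. -/
theorem exists_extension_of_local {E Z X Y : Type*} [AddCommGroup E] [Module ℂ E]
    [TopologicalSpace E] [IsTopologicalAddGroup E] [ContinuousSMul ℂ E] [LocallyConvexSpace ℝ E]
    [T2Space E] [AddCommGroup Z] [Module ℂ Z] [TopologicalSpace Z] [T2Space Z]
    [AddCommGroup X] [Module ℂ X] [TopologicalSpace X]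
    [AddCommGroup Y] [Module ℂ Y] [TopologicalSpace Y]
    {R : BanachSpectrum E} (hR : R.IsContinuous) {S : BanachSpectrum Z} (hS : S.IsContinuous)
    {N : ℕ} (happ : S.IsApproximable R N) {SY : BanachSpectrum Y} (hSY : SY.IsInd)
    (ι : X →L[ℂ] Y) (Q : Y →L[ℂ] Z) (hex : Function.Exact ι Q) (hQ : Function.Surjective Q)
    (T : X →L[ℂ] E)
    (hloc : ∀ n, ∃ P : SY.F n →L[ℂ] E, ∀ y x, SY.ι n y = ι x → P y = T x) :
    ∃ T' : Y →L[ℂ] E, T'.comp ι = T := by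
  obtain ⟨φ, hφ, hφapp⟩ := happ.exists_subsequence
  have hlift : ∀ i, ∃ (l : ℕ) (C : ℝ), 0 < C ∧ ∀ z : S.F (φ i), ∃ y : SY.F l,
      Q (SY.ι l y) = S.ι (φ i) z ∧ ‖y‖ ≤ C * ‖z‖ := by
    intro i
    refine exists_bounded_lift (S.ι (φ i)) (hS _) (fun l => Q.toLinearMap.comp (SY.ι l))
      (fun l => Q.continuous.comp (hSY.isContinuous l)) fun z => ?_
    obtain ⟨y, hy⟩ := hQ (S.ι (φ i) z)
    obtain ⟨n, y, rfl⟩ := SY.exhausts y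
    exact ⟨n, y, hy⟩
  choose l₀ C₀ hC₀ hlift using hlift
  -- A monotone index that dominates both `l₀ i`, so that lifts exist, and `i`, so that the steps
  -- exhaust `Y`.
  let l : ℕ → ℕ := fun i => ∑ j ∈ Finset.range (i + 1), l₀ j + i
  have hl₀ : ∀ i, l₀ i ≤ l i := fun i =>
    (Finset.single_le_sum (fun _ _ => Nat.zero_le _) (Finset.self_mem_range_succ i)).trans
      (Nat.le_add_right _ _)
  have hli : ∀ i, i ≤ l i := fun i => Nat.le_add_left _ _
  have hl : Monotone l := monotone_nat_of_le_succ fun i => by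
    simp only [l]
    rw [Finset.sum_range_succ _ (i + 1)]
    omega
  choose P hP using fun i => hloc (l i)
  have hPker : ∀ i y, Q (SY.ι (l i) y) = 0 →
      (((P (i + 1)).comp (SY.incl (hl (Nat.le_succ i)))) - P i) y = 0 := by
    intro i y hy
    obtain ⟨x, hx⟩ := (hex _).1 hy
    rw [sub_apply, ContinuousLinearMap.comp_apply, hP i y x hx.symm,
      hP (i + 1) _ x (by rw [SY.ι_incl, hx]), sub_self]
  have hc : ∀ i, ∃ c : S.F (φ i) →L[ℂ] E, ∀ z y, Q (SY.ι (l i) y) = S.ι (φ i) z →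
      c z = (((P (i + 1)).comp (SY.incl (hl (Nat.le_succ i)))) - P i) y := by
    intro i
    refine exists_descended_map hR (Q.toLinearMap.comp (SY.ι (l i))) (S.ι (φ i))
      (‖SY.incl (hl₀ i)‖ * C₀ i) (fun z => ?_) _ (hPker i)
    obtain ⟨y, hy, hyC⟩ := hlift i z
    refine ⟨SY.incl (hl₀ i) y, ?_, ?_⟩
    · rw [LinearMap.comp_apply, SY.ι_incl]; exact hy
    · rw [mul_assoc]
      exact ((SY.incl (hl₀ i)).le_opNorm y).trans
        (mul_le_mul_of_nonneg_left hyC (norm_nonneg _))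
  choose c hc using hc
  obtain ⟨U, hU⟩ := BanachSpectrum.exists_coboundary hR hφ.monotone hφapp c
  -- `Q` need not map step `l i` of `Y` into step `φ i` of `Z`. The corrected operator `P i y - U i
  -- z` is therefore defined on their fibre product over `Z`.
  let W : ∀ i, Submodule ℂ (SY.F (l i) × S.F (φ i)) := fun i =>
    LinearMap.ker ((Q.toLinearMap.comp (SY.ι (l i))).comp (LinearMap.fst ℂ _ _) -
      (S.ι (φ i)).comp (LinearMap.snd ℂ _ _))
  have hW : ∀ i y z, (y, z) ∈ W i ↔ Q (SY.ι (l i) y) = S.ι (φ i) z := fun i y z => by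
    simp [W, sub_eq_zero]
  obtain ⟨T', hT'⟩ := exists_glued_linearMap (W := fun i => W i)
    (fun i => (SY.ι (l i)).comp ((LinearMap.fst ℂ _ _).comp (W i).subtype))
    (fun i => (P i).toLinearMap.comp ((LinearMap.fst ℂ _ _).comp (W i).subtype) -
      (U i).toLinearMap.comp ((LinearMap.snd ℂ _ _).comp (W i).subtype))
    (by
      rintro i ⟨⟨y, z⟩, hyz⟩
      rw [hW] at hyz
      refine ⟨⟨(SY.incl (hl (Nat.le_succ i)) y, S.incl (hφ.monotone (Nat.le_succ i)) z), ?_⟩,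
        ?_, ?_⟩
      · rw [hW, SY.ι_incl, S.ι_incl, hyz]
      · simp [SY.ι_incl]
      · have h1 := hc i z y hyz
        rw [hU] at h1
        simp only [sub_apply, ContinuousLinearMap.comp_apply] at h1
        simp only [LinearMap.sub_apply, LinearMap.comp_apply, Submodule.subtype_apply,
          LinearMap.fst_apply, LinearMap.snd_apply, ContinuousLinearMap.coe_coe]
        rw [sub_eq_sub_iff_add_eq_add] at h1 ⊢
        exact h1.symm.trans (add_comm _ _))
    (by
      rintro i ⟨⟨y, z⟩, hyz⟩ h
      rw [hW] at hyz
      have hy : y = 0 := (map_eq_zero_iff _ (SY.ι_injective _)).1 h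
      subst hy
      have hz : z = 0 := (map_eq_zero_iff _ (S.ι_injective _)).1 (by rw [← hyz]; simp)
      simp [hz])
    (by
      intro y
      obtain ⟨n, y, rfl⟩ := SY.exhausts y
      obtain ⟨m, z, hz⟩ := S.exhausts (Q (SY.ι n y))
      have hn : n ≤ l (max n m) := (le_max_left n m).trans (hli _)
      have hm : m ≤ φ (max n m) := (le_max_right n m).trans (hφ.id_le _)
      refine ⟨max n m, ⟨(SY.incl hn y, S.incl hm z), ?_⟩, ?_⟩
      · rw [hW, SY.ι_incl, S.ι_incl, hz]
      · simp [SY.ι_incl])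
  have key : ∀ i y z, Q (SY.ι (l i) y) = S.ι (φ i) z → T' (SY.ι (l i) y) = P i y - U i z :=
    fun i y z h => hT' i ⟨(y, z), (hW i y z).2 h⟩
  refine ⟨⟨T', hSY.continuous T' fun n => ?_⟩, ?_⟩
  · obtain ⟨m, q, hq⟩ := hS.exists_factorization (Q.comp (hSY.isContinuous.ιL n))
    have hn : n ≤ l (max n m) := (le_max_left n m).trans (hli _)
    have hm : m ≤ φ (max n m) := (le_max_right n m).trans (hφ.id_le _)
    have : (fun y => T' (SY.ι n y)) = fun y =>
        P (max n m) (SY.incl hn y) - U (max n m) (S.incl hm (q y)) := by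
      funext y
      rw [← SY.ι_incl hn]
      refine key _ _ _ ?_
      rw [SY.ι_incl, S.ι_incl, hq]
      rfl
    rw [this]
    fun_prop
  · ext x
    obtain ⟨n, y, hy⟩ := SY.exhausts (ι x)
    have h1 : SY.ι (l n) (SY.incl (hli n) y) = ι x := by rw [SY.ι_incl, hy]
    have h2 := key n (SY.incl (hli n) y) 0 (by
      rw [h1, map_zero]; exact (hex _).2 ⟨x, rfl⟩)
    rw [h1, map_zero, sub_zero, hP n _ x h1] at h2
    exact h2

/-! ### Weighted sequence spaces as spectra. -/

theorem continuous_inductiveTopology {X : Type*} [AddCommGroup X] [Module ℂ X] {F : ℕ → Type*}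
    [∀ n, AddCommGroup (F n)] [∀ n, Module ℂ (F n)] [∀ n, TopologicalSpace (F n)]
    (ι : ∀ n, F n →ₗ[ℂ] X) (n : ℕ) : Continuous[_, inductiveTopology ι] (ι n) :=
  continuous_sInf_rng.2 fun _ ht => ht.2.2.2 n

/-- Multiplication by a function that is bounded by `1`, on `ℓ^p`. -/
def lpMul {I : Type*} (p : ℝ≥0∞) [Fact (1 ≤ p)] (b : I → ℝ) (hb : ∀ i, |b i| ≤ 1) :
    lp (fun _ : I => ℂ) p →L[ℂ] lp (fun _ : I => ℂ) p :=
  have h : ∀ (c : lp (fun _ : I => ℂ) p) i, ‖(b i : ℂ) * c i‖ ≤ ‖c i‖ := fun c i => by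
    rw [norm_mul, Complex.norm_real, Real.norm_eq_abs]
    exact mul_le_of_le_one_left (norm_nonneg _) (hb i)
  LinearMap.mkContinuous
    { toFun := fun c => ⟨fun i => (b i : ℂ) * c i, (lp.memℓp c).mono' (h c)⟩
      map_add' := fun c d => lp.ext (funext fun i => mul_add _ _ _)
      map_smul' := fun s c => lp.ext (funext fun i => mul_left_comm _ _ _) } 1 fun c => by
    rw [one_mul]
    exact lp.norm_mono (zero_lt_one.trans_le Fact.out).ne' (h c)

@[simp]
theorem lpMul_apply {I : Type*} (p : ℝ≥0∞) [Fact (1 ≤ p)] (b : I → ℝ) (hb : ∀ i, |b i| ≤ 1)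
    (c : lp (fun _ : I => ℂ) p) (i : I) : lpMul p b hb c i = (b i : ℂ) * c i := rfl

namespace KSpace

variable {I : Type*} (p : ℝ≥0∞) {a : ℕ → I → ℝ}

/-- Division by the weight, `c ↦ c / a`, as a map `ℓ^p(I) → ℓ^p(a)`. -/
def divWeight (w : I → ℝ) (hw : ∀ j, 0 < w j) :
    lp (fun _ : I => ℂ) p →ₗ[ℂ] WeightedLp p w where
  toFun c := ⟨fun j => (w j : ℂ)⁻¹ * c j, by
    have : (fun j => (w j : ℂ) * ((w j : ℂ)⁻¹ * c j)) = c := funext fun j =>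
      mul_inv_cancel_left₀ (by exact_mod_cast (hw j).ne') _
    change Memℓp _ p
    rw [this]
    exact lp.memℓp c⟩
  map_add' c d := Subtype.ext (funext fun j => mul_add _ _ _)
  map_smul' s c := Subtype.ext (funext fun j => mul_left_comm _ _ _)

theorem mulWeight_divWeight (w : I → ℝ) (hw : ∀ j, 0 < w j) (c : lp (fun _ : I => ℂ) p) :
    WeightedLp.mulWeight p w (divWeight p w hw c) = c :=
  lp.ext (funext fun j => mul_inv_cancel_left₀ (by exact_mod_cast (hw j).ne') _)

theorem weightedLpSubmodule_mono (hpos : ∀ n j, 0 < a n j) (hanti : ∀ n j, a (n + 1) j ≤ a n j) :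
    Monotone fun n => weightedLpSubmodule p (a n) := by
  refine monotone_nat_of_le_succ fun n c hc => Memℓp.mono' hc fun j => ?_
  rw [norm_mul, norm_mul, Complex.norm_real, Complex.norm_real, Real.norm_of_nonneg (hpos _ _).le,
    Real.norm_of_nonneg (hpos _ _).le]
  exact mul_le_mul_of_nonneg_right (hanti n j) (norm_nonneg _)

variable [Fact (1 ≤ p)]

theorem continuous_divWeight (w : I → ℝ) (hw : ∀ j, 0 < w j) :
    Continuous (divWeight p w hw) := by
  rw [continuous_induced_rng (f := WeightedLp.mulWeight p w)]
  have : WeightedLp.mulWeight p w ∘ divWeight p w hw = id :=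
    funext (mulWeight_divWeight p w hw)
  rw [this]
  exact continuous_id

theorem abs_div_le_one (hpos : ∀ n j, 0 < a n j) (hanti : ∀ n j, a (n + 1) j ≤ a n j) {n m : ℕ}
    (h : n ≤ m) (j : I) : |a m j / a n j| ≤ 1 := by
  rw [abs_of_pos (div_pos (hpos _ _) (hpos _ _)), div_le_one (hpos _ _)]
  exact antitone_nat_of_succ_le (f := fun n => a n j) (fun n => hanti n j) h

/-- The spectrum of weighted `ℓ^p`-spaces defining `k^p(A)`; all its steps are identified with the
unweighted space. -/
def spectrum (hpos : ∀ n j, 0 < a n j) (hanti : ∀ n j, a (n + 1) j ≤ a n j) :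
    BanachSpectrum (KSpace p a) where
  F _ := lp (fun _ : I => ℂ) p
  normedAddCommGroup _ := inferInstance
  normedSpace _ := inferInstance
  completeSpace _ := inferInstance
  ι n := (ofStep p a n).comp (divWeight p (a n) (hpos n))
  ι_injective n := by
    have h : Function.Injective (ofStep p a n) := Submodule.inclusion_injective _
    exact h.comp (Function.LeftInverse.injective (mulWeight_divWeight p (a n) (hpos n)))
  incl {n m} h := lpMul p (fun j => a m j / a n j) (abs_div_le_one hpos hanti h)
  ι_incl {n m} h c := by
    refine Subtype.ext (funext fun j => ?_)
    change (a m j : ℂ)⁻¹ * (((a m j / a n j : ℝ) : ℂ) * c j) = (a n j : ℂ)⁻¹ * c j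
    have h1 : (a m j : ℂ) ≠ 0 := by exact_mod_cast (hpos m j).ne'
    rw [Complex.ofReal_div]
    field_simp
  exhausts x := by
    obtain ⟨n, hn⟩ := (Submodule.mem_iSup_of_directed _
      (weightedLpSubmodule_mono p hpos hanti).directed_le).1 x.2
    refine ⟨n, WeightedLp.mulWeight p (a n) ⟨x.1, hn⟩, Subtype.ext (funext fun j => ?_)⟩
    exact inv_mul_cancel_left₀ (by exact_mod_cast (hpos n j).ne') _

theorem spectrum_isContinuous (hpos : ∀ n j, 0 < a n j) (hanti : ∀ n j, a (n + 1) j ≤ a n j) :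
    (spectrum p hpos hanti).IsContinuous := fun n =>
  (continuous_inductiveTopology (ofStep p a) n).comp (continuous_divWeight p (a n) (hpos n))

end KSpace

namespace BanachSpectrum

/-- Transport of a spectrum along a linear equivalence. -/
def congr.{u} {X E : Type u} [AddCommGroup X] [Module ℂ X] [AddCommGroup E] [Module ℂ E]
    (S : BanachSpectrum X) (e : X ≃ₗ[ℂ] E) : BanachSpectrum E where
  F := S.F
  normedAddCommGroup := S.normedAddCommGroup
  normedSpace := S.normedSpace
  completeSpace := S.completeSpace
  ι n := e.toLinearMap.comp (S.ι n)
  ι_injective n := e.injective.comp (S.ι_injective n)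
  incl := S.incl
  ι_incl h x := congrArg e (S.ι_incl h x)
  exhausts x := by
    obtain ⟨n, y, hy⟩ := S.exhausts (e.symm x)
    exact ⟨n, y, by rw [LinearMap.comp_apply, hy]; exact e.apply_symm_apply x⟩

/-- An identification of the steps of a spectrum with spaces `ℓ^p(a n)`. -/
structure LpModel {X : Type*} [AddCommGroup X] [Module ℂ X] (S : BanachSpectrum X) (p : ℝ≥0∞)
    [Fact (1 ≤ p)] (I : Type*) where
  weight : ℕ → I → ℝ
  weight_pos : ∀ n j, 0 < weight n j
  equiv : ∀ n, S.F n ≃ₗᵢ[ℂ] lp (fun _ : I => ℂ) p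
  equiv_incl : ∀ {n m : ℕ} (h : n ≤ m) (x : S.F n) (j : I),
    equiv m (S.incl h x) j = ((weight m j / weight n j : ℝ) : ℂ) * equiv n x j

end BanachSpectrum

theorem IsKSpace.exists_lpModel.{u} {p : ℝ≥0∞} [Fact (1 ≤ p)] {E : Type u} [AddCommGroup E]
    [Module ℂ E] [TopologicalSpace E] (h : IsKSpace p E) :
    ∃ S : BanachSpectrum E, S.IsContinuous ∧ ∃ I : Type u, Nonempty (S.LpModel p I) := by
  obtain ⟨I, a, hpos, hanti, ⟨e⟩⟩ := h
  exact ⟨(KSpace.spectrum p hpos hanti).congr e.symm.toLinearEquiv,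
    fun n => e.symm.continuous.comp (KSpace.spectrum_isContinuous p hpos hanti n), I,
    ⟨⟨a, hpos, fun n => LinearIsometryEquiv.refl ℂ (lp (fun _ : I => ℂ) p), fun h x j => rfl⟩⟩⟩

/-! ### Sums of rank one operators, and operators into `ℓ^∞` or out of `ℓ^1`. -/

section Sums

variable {H G : Type*} [NormedAddCommGroup H] [NormedSpace ℂ H] [NormedAddCommGroup G]
  [NormedSpace ℂ G]

/-- Rank one operators can be summed if they are absolutely summable at each point. -/
theorem exists_hasSum_smul [CompleteSpace G] {J : Type*} (f : J → H →L[ℂ] ℂ) (y : J → G) (C : ℝ)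
    (h : ∀ x, ∃ s, HasSum (fun j => ‖f j x‖ * ‖y j‖) s ∧ s ≤ C * ‖x‖) :
    ∃ T : H →L[ℂ] G, (∀ x, ‖T x‖ ≤ C * ‖x‖) ∧ ∀ x, HasSum (fun j => f j x • y j) (T x) := by
  have hs : ∀ x, Summable fun j => f j x • y j := fun x => by
    obtain ⟨s, hs, -⟩ := h x
    exact Summable.of_norm_bounded hs.summable fun j => (norm_smul _ _).le
  have hC : ∀ x, ‖∑' j, f j x • y j‖ ≤ C * ‖x‖ := fun x => by
    obtain ⟨s, hs, hsC⟩ := h x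
    exact (tsum_of_norm_bounded hs fun j => (norm_smul _ _).le).trans hsC
  refine ⟨LinearMap.mkContinuous
    { toFun := fun x => ∑' j, f j x • y j
      map_add' := fun u v => by
        rw [← (hs u).tsum_add (hs v)]
        simp only [map_add, add_smul]
      map_smul' := fun c u => by
        rw [RingHom.id_apply, ← (hs u).tsum_const_smul]
        simp only [map_smul, smul_assoc] } C hC, hC, fun x => (hs x).hasSum⟩

/-- Absolutely summable rank one operators can be summed. -/
theorem exists_hasSum_smul_of_summable [CompleteSpace G] {J : Type*} (f : J → H →L[ℂ] ℂ)
    (y : J → G) {s : ℝ} (h : HasSum (fun j => ‖f j‖ * ‖y j‖) s) :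
    ∃ T : H →L[ℂ] G, ‖T‖ ≤ s ∧ ∀ x, HasSum (fun j => f j x • y j) (T x) := by
  have hle : ∀ x j, ‖f j x‖ * ‖y j‖ ≤ ‖f j‖ * ‖y j‖ * ‖x‖ := fun x j => by
    rw [mul_right_comm]
    exact mul_le_mul_of_nonneg_right ((f j).le_opNorm x) (norm_nonneg _)
  obtain ⟨T, hT, hT'⟩ := exists_hasSum_smul f y s fun x => by
    have h1 := h.mul_right ‖x‖
    have h2 : Summable fun j => ‖f j x‖ * ‖y j‖ :=
      Summable.of_nonneg_of_le (fun j => by positivity) (hle x) h1.summable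
    exact ⟨_, h2.hasSum, hasSum_le (hle x) h2.hasSum h1⟩
  exact ⟨T, T.opNorm_le_bound (h.nonneg fun j => by positivity) hT, hT'⟩

/-- Bounded families of functionals define operators with values in `ℓ^∞`. -/
theorem exists_clm_linfty {I : Type*} (f : I → H →L[ℂ] ℂ) {C : ℝ} (hC : 0 ≤ C)
    (hf : ∀ i, ‖f i‖ ≤ C) :
    ∃ T : H →L[ℂ] lp (fun _ : I => ℂ) ∞, ‖T‖ ≤ C ∧ ∀ x i, T x i = f i x := by
  have h : ∀ x i, ‖f i x‖ ≤ C * ‖x‖ := fun x i => (f i).le_of_opNorm_le (hf i) x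
  refine ⟨LinearMap.mkContinuous
    { toFun := fun x => ⟨fun i => f i x, memℓp_infty ⟨C * ‖x‖, by rintro _ ⟨i, rfl⟩; exact h x i⟩⟩
      map_add' := fun x y => lp.ext (funext fun i => map_add (f i) x y)
      map_smul' := fun c x => lp.ext (funext fun i => map_smul (f i) c x) } C fun x =>
      lp.norm_le_of_forall_le (by positivity) (h x), LinearMap.mkContinuous_norm_le _ hC _,
    fun x i => rfl⟩

/-- The coordinate functionals on `ℓ^p`. -/
def lpCoord {I : Type*} (p : ℝ≥0∞) [Fact (1 ≤ p)] (i : I) : lp (fun _ : I => ℂ) p →L[ℂ] ℂ :=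
  LinearMap.mkContinuous
    { toFun := fun c => c i
      map_add' := fun c d => rfl
      map_smul' := fun s c => rfl } 1 fun c => by
    rw [one_mul]
    exact lp.norm_apply_le_norm (zero_lt_one.trans_le Fact.out).ne' c i

@[simp]
theorem lpCoord_apply {I : Type*} (p : ℝ≥0∞) [Fact (1 ≤ p)] (i : I) (c : lp (fun _ : I => ℂ) p) :
    lpCoord p i c = c i := rfl

theorem norm_lpCoord_le {I : Type*} (p : ℝ≥0∞) [Fact (1 ≤ p)] (i : I) : ‖lpCoord p i‖ ≤ 1 :=
  LinearMap.mkContinuous_norm_le _ zero_le_one _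

theorem hasSum_norm_lp_one {I : Type*} (c : lp (fun _ : I => ℂ) 1) :
    HasSum (fun i => ‖c i‖) ‖c‖ := by
  simpa using lp.hasSum_norm (p := 1) (by simp) c

/-- Bounded families of vectors define operators on `ℓ^1`. -/
theorem exists_clm_lone [CompleteSpace G] {I : Type*} (y : I → G) {C : ℝ} (hC : 0 ≤ C)
    (hy : ∀ i, ‖y i‖ ≤ C) :
    ∃ T : lp (fun _ : I => ℂ) 1 →L[ℂ] G, ‖T‖ ≤ C ∧ ∀ c, HasSum (fun i => c i • y i) (T c) := by
  obtain ⟨T, hT, hT'⟩ := exists_hasSum_smul (lpCoord 1) y C fun c => by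
    have h1 := (hasSum_norm_lp_one c).mul_left C
    have hle : ∀ i, ‖lpCoord 1 i c‖ * ‖y i‖ ≤ C * ‖c i‖ := fun i => by
      rw [mul_comm]
      exact mul_le_mul_of_nonneg_right (hy i) (norm_nonneg _)
    have h2 : Summable fun i => ‖lpCoord 1 i c‖ * ‖y i‖ :=
      Summable.of_nonneg_of_le (fun i => by positivity) hle h1.summable
    exact ⟨_, h2.hasSum, hasSum_le hle h2.hasSum h1⟩
  exact ⟨T, T.opNorm_le_bound hC hT, hT'⟩

open Classical in
theorem hasSum_lp_one_single {I : Type*} (c : lp (fun _ : I => ℂ) 1) :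
    HasSum (fun i => c i • lp.single (E := fun _ : I => ℂ) 1 i (1 : ℂ)) c := by
  have := lp.hasSum_single (p := 1) ENNReal.one_ne_top c
  convert this using 2 with i
  rw [← lp.single_smul, smul_eq_mul, mul_one]

end Sums

/-! ### Local extension in the four cases. -/

section LocalExtension

variable {E Z X Y : Type*} [AddCommGroup E] [Module ℂ E]
    [TopologicalSpace E] [AddCommGroup Z] [Module ℂ Z] [TopologicalSpace Z]
    [AddCommGroup X] [Module ℂ X] [TopologicalSpace X]
    [AddCommGroup Y] [Module ℂ Y] [TopologicalSpace Y]

/-- The part of the kernel of `Q` in the `n`-th step. -/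
def BanachSpectrum.stepKer (SY : BanachSpectrum Y) (Q : Y →L[ℂ] Z) (n : ℕ) :
    Submodule ℂ (SY.F n) :=
  LinearMap.ker (Q.toLinearMap.comp (SY.ι n))

theorem BanachSpectrum.mem_stepKer {SY : BanachSpectrum Y} {Q : Y →L[ℂ] Z} {n : ℕ} {y : SY.F n} :
    y ∈ SY.stepKer Q n ↔ Q (SY.ι n y) = 0 := Iff.rfl

variable [T2Space Z]

theorem BanachSpectrum.IsContinuous.completeSpace_stepKer {SY : BanachSpectrum Y}
    (hSY : SY.IsContinuous) (Q : Y →L[ℂ] Z) (n : ℕ) : CompleteSpace (SY.stepKer Q n) :=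
  (isClosed_singleton.preimage (Q.continuous.comp (hSY n))).completeSpace_coe

/-- A continuous linear map on the kernel of `Q` is continuous for the norms of the steps. -/
theorem exists_clm_stepKer [T2Space Y] {SX : BanachSpectrum X} (hSX : SX.IsContinuous)
    {SY : BanachSpectrum Y} (hSY : SY.IsContinuous) (ι : X →L[ℂ] Y) (Q : Y →L[ℂ] Z)
    (hι : Function.Injective ι) (hex : Function.Exact ι Q) (T : X →L[ℂ] E) (n : ℕ) :
    ∃ T' : SY.stepKer Q n →L[ℂ] E,
      ∀ (y : SY.stepKer Q n) (x : X), SY.ι n y = ι x → T' y = T x := by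
  have := hSY.completeSpace_stepKer Q n
  obtain ⟨m, f, hf⟩ := exists_factorization ((SY.ι n).comp (SY.stepKer Q n).subtype)
    ((hSY n).comp continuous_subtype_val) (fun m => ι.toLinearMap.comp (SX.ι m))
    (fun m => ι.continuous.comp (hSX m)) (fun m => hι.comp (SX.ι_injective m)) (by
      rintro ⟨y, hy⟩
      obtain ⟨x, hx⟩ := (hex _).1 hy
      obtain ⟨m, x, rfl⟩ := SX.exhausts x
      exact ⟨m, x, hx⟩)
  refine ⟨(T.comp (hSX.ιL m)).comp f, fun y x hyx => ?_⟩
  have h : SX.ι m (f y) = x := hι ((hf y).trans hyx)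
  simp [h]

/-- Local extension by means of local lifts. -/
theorem exists_local_extension_of_lift [IsTopologicalAddGroup E] [T2Space Y]
    {SX : BanachSpectrum X} (hSX : SX.IsContinuous)
    {SY : BanachSpectrum Y} (hSY : SY.IsContinuous) {S : BanachSpectrum Z} (hS : S.IsContinuous)
    (ι : X →L[ℂ] Y) (Q : Y →L[ℂ] Z) (hι : Function.Injective ι) (hex : Function.Exact ι Q)
    (hlift : ∀ m, ∃ (l : ℕ) (r : S.F m →L[ℂ] SY.F l), ∀ z, Q (SY.ι l (r z)) = S.ι m z)
    (T : X →L[ℂ] E) (n : ℕ) :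
    ∃ P : SY.F n →L[ℂ] E, ∀ y x, SY.ι n y = ι x → P y = T x := by
  obtain ⟨m, q, hq⟩ := hS.exists_factorization (Q.comp (hSY.ιL n))
  obtain ⟨l, r, hr⟩ := hlift m
  obtain ⟨T', hT'⟩ := exists_clm_stepKer hSX hSY ι Q hι hex T (max n l)
  -- Subtracting the lift of `Q y` from `y` lands in the kernel of `Q`, and changes nothing if `y`
  -- is already in the kernel.
  let w : SY.F n →L[ℂ] SY.F (max n l) :=
    SY.incl (le_max_left n l) - (SY.incl (le_max_right n l)).comp (r.comp q)
  have hw : ∀ y, w y ∈ SY.stepKer Q (max n l) := fun y => by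
    rw [BanachSpectrum.mem_stepKer]
    simp [w, SY.ι_incl, hr, hq]
  refine ⟨T'.comp (w.codRestrict _ hw), fun y x hyx => ?_⟩
  refine hT' _ _ ?_
  have hqy : q y = 0 := S.ι_injective m (by
    rw [hq, map_zero]
    change Q (SY.ι n y) = 0
    rw [hyx]
    exact (hex _).2 ⟨x, rfl⟩)
  simp [w, SY.ι_incl, hqy, hyx]

/-- Lifts through `Q` of operators that are pointwise absolutely convergent sums of rank one
operators. -/
theorem exists_lift_of_hasSum {SY : BanachSpectrum Y} (hSY : SY.IsContinuous)
    {S : BanachSpectrum Z} (hS : S.IsContinuous) (Q : Y →L[ℂ] Z) (hQ : Function.Surjective Q)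
    {m m' : ℕ} (hm : m ≤ m') {J : Type*} (f : J → S.F m →L[ℂ] ℂ) (z : J → S.F m') (C : ℝ)
    (hf : ∀ x, ∃ s, HasSum (fun j => ‖f j x‖ * ‖z j‖) s ∧ s ≤ C * ‖x‖)
    (hsum : ∀ x, HasSum (fun j => f j x • z j) (S.incl hm x)) :
    ∃ (l : ℕ) (r : S.F m →L[ℂ] SY.F l), ∀ x, Q (SY.ι l (r x)) = S.ι m x := by
  obtain ⟨l, D, hD, hlift⟩ := exists_bounded_lift (S.ι m') (hS m')
    (fun l => Q.toLinearMap.comp (SY.ι l)) (fun l => Q.continuous.comp (hSY l)) fun z => by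
      obtain ⟨y, hy⟩ := hQ (S.ι m' z)
      obtain ⟨n, y, rfl⟩ := SY.exhausts y
      exact ⟨n, y, hy⟩
  -- The vectors are lifted one at a time into one step with a uniform bound, so the sum stays
  -- absolutely convergent.
  choose y hy hyD using fun j => hlift (z j)
  obtain ⟨r, -, hr⟩ := exists_hasSum_smul f y (D * C) fun x => by
    obtain ⟨s, hs, hsC⟩ := hf x
    have h1 := hs.mul_left D
    have hle : ∀ j, ‖f j x‖ * ‖y j‖ ≤ D * (‖f j x‖ * ‖z j‖) := fun j => by
      rw [mul_left_comm]
      exact mul_le_mul_of_nonneg_left (hyD j) (norm_nonneg _)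
    have h2 : Summable fun j => ‖f j x‖ * ‖y j‖ :=
      Summable.of_nonneg_of_le (fun j => by positivity) hle h1.summable
    refine ⟨_, h2.hasSum, (hasSum_le hle h2.hasSum h1).trans ?_⟩
    rw [mul_assoc]
    exact mul_le_mul_of_nonneg_left hsC hD.le
  refine ⟨l, r, fun x => ?_⟩
  have h1 := (hr x).mapL (Q.comp (hSY.ιL l))
  have h2 := (hsum x).mapL (hS.ιL m')
  have h3 : ∀ j, (Q.comp (hSY.ιL l)) (f j x • y j) = hS.ιL m' (f j x • z j) := fun j => by
    rw [map_smul, map_smul]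
    exact congrArg _ (hy j)
  simp only [h3] at h1
  have := h1.unique h2
  rwa [hS.ιL_apply, S.ι_incl] at this

/-- This is the projectivity of `ℓ^1`: expand in unit vectors and lift these. -/
theorem BanachSpectrum.LpModel.exists_lift {SY : BanachSpectrum Y} (hSY : SY.IsContinuous)
    {S : BanachSpectrum Z} (hS : S.IsContinuous) {I : Type*} (L : S.LpModel 1 I) (Q : Y →L[ℂ] Z)
    (hQ : Function.Surjective Q) (m : ℕ) :
    ∃ (l : ℕ) (r : S.F m →L[ℂ] SY.F l), ∀ x, Q (SY.ι l (r x)) = S.ι m x := by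
  classical
  let e : S.F m →L[ℂ] lp (fun _ : I => ℂ) 1 := (L.equiv m).toContinuousLinearEquiv
  refine exists_lift_of_hasSum hSY hS Q hQ le_rfl (fun i => (lpCoord 1 i).comp e)
    (fun i => (L.equiv m).symm (lp.single (E := fun _ : I => ℂ) 1 i (1 : ℂ))) 1
    (fun x => ⟨‖x‖, ?_, (one_mul _).ge⟩) fun x => ?_
  · have := hasSum_norm_lp_one (L.equiv m x)
    rw [LinearIsometryEquiv.norm_map] at this
    convert this using 2 with i
    rw [LinearIsometryEquiv.norm_map, lp.norm_single zero_lt_one, norm_one, mul_one]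
    rfl
  · have := (hasSum_lp_one_single (L.equiv m x)).mapL
      ((L.equiv m).symm.toContinuousLinearEquiv : lp (fun _ : I => ℂ) 1 →L[ℂ] S.F m)
    rw [incl_refl]
    convert this using 2 with i
    · rw [map_smul]; rfl
    · exact ((L.equiv m).symm_apply_apply x).symm

theorem exists_lift_of_isNuclearMap {SY : BanachSpectrum Y} (hSY : SY.IsContinuous)
    {S : BanachSpectrum Z} (hS : S.IsContinuous)
    (hnuc : ∀ n, IsNuclearMap (S.incl (Nat.le_succ n))) (Q : Y →L[ℂ] Z)
    (hQ : Function.Surjective Q) (m : ℕ) :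
    ∃ (l : ℕ) (r : S.F m →L[ℂ] SY.F l), ∀ x, Q (SY.ι l (r x)) = S.ι m x := by
  obtain ⟨f, z, hs, hsum⟩ := hnuc m
  refine exists_lift_of_hasSum hSY hS Q hQ (Nat.le_succ m) f z (∑' j, ‖f j‖ * ‖z j‖) (fun x => ?_)
    hsum
  have h1 := hs.hasSum.mul_right ‖x‖
  have hle : ∀ j, ‖f j x‖ * ‖z j‖ ≤ ‖f j‖ * ‖z j‖ * ‖x‖ := fun j => by
    rw [mul_right_comm]
    exact mul_le_mul_of_nonneg_right ((f j).le_opNorm x) (norm_nonneg _)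
  have h2 : Summable fun j => ‖f j x‖ * ‖z j‖ :=
    Summable.of_nonneg_of_le (fun j => by positivity) hle h1.summable
  exact ⟨_, h2.hasSum, hasSum_le hle h2.hasSum h1⟩

/-- Local extension when `E` has steps isometric to `ℓ^∞`. -/
theorem BanachSpectrum.LpModel.exists_local_extension [T2Space Y] [T2Space E]
    {SX : BanachSpectrum X} (hSX : SX.IsContinuous) {SY : BanachSpectrum Y}
    (hSY : SY.IsContinuous) {R : BanachSpectrum E} (hR : R.IsContinuous) {I : Type*}
    (L : R.LpModel ∞ I) (ι : X →L[ℂ] Y) (Q : Y →L[ℂ] Z) (hι : Function.Injective ι)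
    (hex : Function.Exact ι Q) (T : X →L[ℂ] E) (n : ℕ) :
    ∃ P : SY.F n →L[ℂ] E, ∀ y x, SY.ι n y = ι x → P y = T x := by
  have := hSY.completeSpace_stepKer Q n
  obtain ⟨T', hT'⟩ := exists_clm_stepKer hSX hSY ι Q hι hex T n
  obtain ⟨M, f, hf⟩ := hR.exists_factorization T'
  let e : R.F M →L[ℂ] lp (fun _ : I => ℂ) ∞ := (L.equiv M).toContinuousLinearEquiv
  -- This is the injectivity of `ℓ^∞`: norm-preserving Hahn-Banach in each coordinate keeps the
  -- family bounded.
  choose g hg hgn using fun i => exists_extension_norm_eq (𝕜 := ℂ) (SY.stepKer Q n)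
    (((lpCoord ∞ i).comp e).comp f)
  obtain ⟨P, -, hP⟩ := exists_clm_linfty g (C := ‖e.comp f‖) (norm_nonneg _) fun i => by
    rw [hgn, ContinuousLinearMap.comp_assoc]
    refine (ContinuousLinearMap.opNorm_comp_le _ _).trans ?_
    exact mul_le_of_le_one_left (norm_nonneg _) (norm_lpCoord_le ∞ i)
  refine ⟨(hR.ιL M).comp
    (((L.equiv M).symm.toContinuousLinearEquiv : lp (fun _ : I => ℂ) ∞ →L[ℂ] R.F M).comp P),
    fun y x hyx => ?_⟩
  have hy : y ∈ SY.stepKer Q n := by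
    rw [mem_stepKer, hyx]
    exact (hex _).2 ⟨x, rfl⟩
  have h1 : P y = L.equiv M (f ⟨y, hy⟩) := lp.ext (funext fun i => by
    rw [hP]
    exact hg i ⟨y, hy⟩)
  rw [← hT' ⟨y, hy⟩ x hyx, ← hf]
  change R.ι M ((L.equiv M).symm (P y)) = _
  rw [h1, LinearIsometryEquiv.symm_apply_apply]

/-- Local extension when the inclusion maps of the spectrum of `E` are nuclear. -/
theorem exists_local_extension_of_isNuclearMap [T2Space Y] [T2Space E]
    {SX : BanachSpectrum X} (hSX : SX.IsContinuous) {SY : BanachSpectrum Y}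
    (hSY : SY.IsContinuous) {R : BanachSpectrum E} (hR : R.IsContinuous)
    (hnuc : ∀ n, IsNuclearMap (R.incl (Nat.le_succ n))) (ι : X →L[ℂ] Y) (Q : Y →L[ℂ] Z)
    (hι : Function.Injective ι) (hex : Function.Exact ι Q) (T : X →L[ℂ] E) (n : ℕ) :
    ∃ P : SY.F n →L[ℂ] E, ∀ y x, SY.ι n y = ι x → P y = T x := by
  have := hSY.completeSpace_stepKer Q n
  obtain ⟨T', hT'⟩ := exists_clm_stepKer hSX hSY ι Q hι hex T n
  obtain ⟨M, f, hf⟩ := hR.exists_factorization T'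
  obtain ⟨φ, e, hs, hsum⟩ := hnuc M
  -- Only the functionals of the nuclear representation are extended; preserved norms keep the
  -- series summable.
  choose g hg hgn using fun j => exists_extension_norm_eq (𝕜 := ℂ) (SY.stepKer Q n)
    ((φ j).comp f)
  have hsg : Summable fun j => ‖g j‖ * ‖e j‖ := by
    refine Summable.of_nonneg_of_le (fun j => by positivity) (fun j => ?_) (hs.mul_left ‖f‖)
    rw [hgn, ← mul_assoc, mul_comm ‖f‖]
    exact mul_le_mul_of_nonneg_right (ContinuousLinearMap.opNorm_comp_le _ _) (norm_nonneg _)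
  obtain ⟨P, -, hP⟩ := exists_hasSum_smul_of_summable g e hsg.hasSum
  refine ⟨(hR.ιL (M + 1)).comp P, fun y x hyx => ?_⟩
  have hy : y ∈ SY.stepKer Q n := by
    rw [BanachSpectrum.mem_stepKer, hyx]
    exact (hex _).2 ⟨x, rfl⟩
  have h1 : P y = R.incl (Nat.le_succ M) (f ⟨y, hy⟩) := by
    refine (hP y).unique ?_
    convert hsum (f ⟨y, hy⟩) using 3 with j
    exact hg j ⟨y, hy⟩
  rw [← hT' ⟨y, hy⟩ x hyx, ← hf]
  change R.ι (M + 1) (P y) = _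
  rw [h1, R.ι_incl]

end LocalExtension

/-! ### Interpolation and splitting of functionals. -/

namespace BanachSpectrum

section Interpolation

variable {Z : Type*} [AddCommGroup Z] [Module ℂ Z] {S : BanachSpectrum Z}

/-- The interpolation inequality of condition (DΩ) in additive form. -/
def Interpolates (S : BanachSpectrum Z) {n m k : ℕ} (hnm : n ≤ m) (hmk : m ≤ k) (γ C : ℝ) : Prop :=
  ∀ (z : S.F n) (r : ℝ), 0 < r →
    ‖S.incl hnm z‖ ≤ C * (r ^ (-γ) * ‖z‖ + r * ‖S.incl (hnm.trans hmk) z‖)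

/-- Weighted AM-GM with weights `θ` and `1 - θ`; for `γ = (1 - θ) / θ` the powers of `r` cancel in
the geometric mean. -/
theorem CondDOmega.exists_interpolates (h : S.CondDOmega) (n : ℕ) :
    ∃ (m : ℕ) (hnm : n ≤ m), ∀ (k : ℕ) (hmk : m ≤ k), ∃ γ : ℝ, 0 < γ ∧ ∃ C : ℝ, 0 < C ∧
      S.Interpolates hnm hmk γ C := by
  obtain ⟨m, hnm, hm⟩ := h n
  refine ⟨m, hnm, fun k hmk => ?_⟩
  obtain ⟨θ, ⟨hθ0, hθ1⟩, C, hC, H⟩ := hm k hmk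
  refine ⟨(1 - θ) / θ, div_pos (sub_pos.2 hθ1) hθ0, C, hC, fun z r hr => (H z).trans ?_⟩
  rw [mul_assoc]
  refine mul_le_mul_of_nonneg_left ?_ hC.le
  set a := ‖z‖ with ha
  set b := ‖S.incl (hnm.trans hmk) z‖ with hb
  have h1 := Real.geom_mean_le_arith_mean2_weighted hθ0.le (sub_pos.2 hθ1).le
    (show 0 ≤ r ^ (-((1 - θ) / θ)) * a by positivity) (show 0 ≤ r * b by positivity) (by ring)
  have h2 : (r ^ (-((1 - θ) / θ)) * a) ^ θ * (r * b) ^ (1 - θ) = a ^ θ * b ^ (1 - θ) := by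
    rw [Real.mul_rpow (by positivity) (by positivity), Real.mul_rpow hr.le (by positivity),
      ← Real.rpow_mul hr.le, show -((1 - θ) / θ) * θ = -(1 - θ) by field_simp,
      Real.rpow_neg hr.le]
    have : r ^ (1 - θ) ≠ 0 := by positivity
    field_simp
  rw [h2] at h1
  refine h1.trans (add_le_add ?_ ?_)
  · exact mul_le_of_le_one_left (by positivity) hθ1.le
  · exact mul_le_of_le_one_left (by positivity) (by linarith)

end Interpolation

end BanachSpectrum

/-- A functional dominated by a sum of two norms splits accordingly. -/
theorem exists_functional_split {F G : Type*} [NormedAddCommGroup F] [NormedSpace ℂ F]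
    [NormedAddCommGroup G] [NormedSpace ℂ G] (B : F →L[ℂ] G) (f : F →ₗ[ℂ] ℂ) {a b : ℝ}
    (ha : 0 ≤ a) (hb : 0 ≤ b) (hf : ∀ z, ‖f z‖ ≤ a * ‖z‖ + b * ‖B z‖) :
    ∃ (h : F →L[ℂ] ℂ) (g : G →L[ℂ] ℂ), ‖h‖ ≤ a ∧ ‖g‖ ≤ b ∧ ∀ z, f z = h z + g (B z) := by
  -- `f` is viewed as a functional on the graph of `B`, dominated by `a ‖x‖ + b ‖y‖`. A Hahn-Banach
  -- extension to the product is then restricted to the two factors.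
  let j : F →ₗ[ℂ] F × G := LinearMap.prod LinearMap.id B.toLinearMap
  have hj : Function.Injective j := fun x y hxy => congrArg Prod.fst hxy
  let e := LinearEquiv.ofInjective j hj
  let a' : NNReal := ⟨a, ha⟩
  let b' : NNReal := ⟨b, hb⟩
  let p : Seminorm ℂ (F × G) := a' • (normSeminorm ℂ F).comp (LinearMap.fst ℂ F G) +
    b' • (normSeminorm ℂ G).comp (LinearMap.snd ℂ F G)
  have hp : ∀ x y, p (x, y) = a * ‖x‖ + b * ‖y‖ := fun x y => rfl
  have hpc : Continuous p := by
    have : (p : F × G → ℝ) = fun x => a * ‖x.1‖ + b * ‖x.2‖ := funext fun x => hp x.1 x.2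
    rw [this]
    fun_prop
  obtain ⟨g, hg, hgp⟩ := Module.Dual.exists_continuous_extension_of_le_seminorm
    (LinearMap.range j) (f.comp e.symm.toLinearMap) hpc (by
      intro x
      obtain ⟨z, rfl⟩ := e.surjective x
      simp only [LinearMap.comp_apply, LinearEquiv.coe_coe, LinearEquiv.symm_apply_apply]
      exact hf z)
  refine ⟨g.comp (ContinuousLinearMap.inl ℂ F G), g.comp (ContinuousLinearMap.inr ℂ F G),
    ContinuousLinearMap.opNorm_le_bound _ ha fun x => ?_,
    ContinuousLinearMap.opNorm_le_bound _ hb fun x => ?_, fun z => ?_⟩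
  · refine (hgp _).trans (le_of_eq ?_)
    simp [hp]
  · refine (hgp _).trans (le_of_eq ?_)
    simp [hp]
  · have h1 := hg (e z)
    simp only [LinearMap.comp_apply, LinearEquiv.coe_coe, LinearEquiv.symm_apply_apply] at h1
    rw [← h1, ContinuousLinearMap.comp_apply, ContinuousLinearMap.comp_apply, ← map_add]
    congr 1
    simp [e, j]

namespace BanachSpectrum

variable {Z : Type*} [AddCommGroup Z] [Module ℂ Z] {S : BanachSpectrum Z}

theorem Interpolates.exists_functional_split {n m k : ℕ} {hnm : n ≤ m} {hmk : m ≤ k} {γ C : ℝ}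
    (hC : 0 < C) (h : S.Interpolates hnm hmk γ C) (f : S.F m →L[ℂ] ℂ) {r : ℝ} (hr : 0 < r) :
    ∃ (h : S.F n →L[ℂ] ℂ) (g : S.F k →L[ℂ] ℂ), ‖h‖ ≤ C * r ^ (-γ) * ‖f‖ ∧ ‖g‖ ≤ C * r * ‖f‖ ∧
      ∀ z, f (S.incl hnm z) = h z + g (S.incl (hnm.trans hmk) z) := by
  refine _root_.exists_functional_split (S.incl (hnm.trans hmk))
    (f.toLinearMap.comp (S.incl hnm).toLinearMap) (by positivity) (by positivity) fun z => ?_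
  refine (f.le_opNorm _).trans ((mul_le_mul_of_nonneg_left (h z r hr) (norm_nonneg f)).trans
    (le_of_eq ?_))
  ring

theorem IsContinuous.exists_factorization_ge {E : Type*} [AddCommGroup E] [Module ℂ E]
    [TopologicalSpace E] [T2Space E] {R : BanachSpectrum E} (hR : R.IsContinuous) (N : ℕ)
    {G : Type*} [NormedAddCommGroup G] [NormedSpace ℂ G] [CompleteSpace G] (f : G →L[ℂ] E) :
    ∃ (M : ℕ) (_ : N ≤ M) (f' : G →L[ℂ] R.F M), ∀ g, R.ι M (f' g) = f g := by
  obtain ⟨m, f', hf'⟩ := hR.exists_factorization f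
  exact ⟨max m N, le_max_right _ _, (R.incl (le_max_left m N)).comp f', fun g => by
    rw [ContinuousLinearMap.comp_apply, R.ι_incl, hf']⟩

end BanachSpectrum

theorem exists_mul_rpow_neg_le {γ ε : ℝ} (hγ : 0 < γ) (hε : 0 < ε) (c : ℝ) :
    ∃ R : ℝ, 0 < R ∧ c * R ^ (-γ) ≤ ε := by
  have h := (tendsto_rpow_neg_atTop hγ).const_mul c
  rw [mul_zero] at h
  obtain ⟨R, hR, hR'⟩ := ((h.eventually (ge_mem_nhds hε)).and (eventually_gt_atTop 0)).exists
  exact ⟨R, hR', hR⟩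

/-! ### Approximation for weighted sequence spaces. -/

namespace BanachSpectrum

section Approximation

variable {Z : Type*} [AddCommGroup Z] [Module ℂ Z] {S : BanachSpectrum Z}
  {E : Type*} [AddCommGroup E] [Module ℂ E] {R : BanachSpectrum E} {N : ℕ}

theorem LpModel.weight_le_of_condA {I : Type*} (L : R.LpModel ∞ I) {M K : ℕ} (hNM : N ≤ M)
    (hMK : M ≤ K) {γ D : ℝ} (hD : 0 < D)
    (h : ∀ r : ℝ, 0 < r → ∀ x : R.F M, ∃ (y : R.F K) (z : R.F N), R.ι M x = R.ι K y + R.ι N z ∧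
      ‖y‖ ≤ r * ‖x‖ ∧ ‖z‖ ≤ D / r ^ γ * ‖x‖) (j : I) :
    L.weight N j / L.weight M j ≤ 2 * D * 2 ^ γ * (L.weight K j / L.weight M j) ^ (-γ) := by
  classical
  have hN := L.weight_pos N j
  have hM := L.weight_pos M j
  have hK := L.weight_pos K j
  set u := L.weight K j / L.weight M j with hu
  have hu0 : 0 < u := div_pos hK hM
  let δ : lp (fun _ : I => ℂ) ∞ := lp.single (E := fun _ : I => ℂ) ∞ j (1 : ℂ)
  -- The unit vector has `j`-th coordinate `u` in step `K`. With `r = u / 2` the first summand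
  -- covers at most half of it, so the second must supply the rest.
  obtain ⟨y, z, hyz, hy, hz⟩ := h (u / 2) (by positivity) ((L.equiv M).symm δ)
  rw [LinearIsometryEquiv.norm_map, lp.norm_single (by simp), norm_one, mul_one] at hy hz
  have h1 : R.incl hMK ((L.equiv M).symm δ) = y + R.incl (hNM.trans hMK) z :=
    R.ι_injective K (by simp only [map_add, R.ι_incl, hyz])
  have h2 : (u : ℂ) = L.equiv K y j + ((L.weight K j / L.weight N j : ℝ) : ℂ) * L.equiv N z j := by
    have h3 := congrArg (fun t => L.equiv K t j) h1
    simp only [map_add] at h3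
    rw [L.equiv_incl, LinearIsometryEquiv.apply_symm_apply, lp.single_apply_self, mul_one] at h3
    rw [h3, ← L.equiv_incl]
    rfl
  have h4 : ‖L.equiv K y j‖ ≤ u / 2 := by
    refine (lp.norm_apply_le_norm ENNReal.top_ne_zero _ j).trans ?_
    rwa [LinearIsometryEquiv.norm_map]
  have h5 : ‖L.equiv N z j‖ ≤ D / (u / 2) ^ γ := by
    refine (lp.norm_apply_le_norm ENNReal.top_ne_zero _ j).trans ?_
    rwa [LinearIsometryEquiv.norm_map]
  have h6 : u ≤ u / 2 + L.weight K j / L.weight N j * (D / (u / 2) ^ γ) := by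
    have h7 := congrArg norm h2
    rw [Complex.norm_real, Real.norm_of_nonneg hu0.le] at h7
    refine h7.le.trans ((norm_add_le _ _).trans (add_le_add h4 ?_))
    rw [norm_mul, Complex.norm_real, Real.norm_of_nonneg (div_pos hK hN).le]
    exact mul_le_mul_of_nonneg_left h5 (div_pos hK hN).le
  have h8 : u ≤ 2 * (L.weight K j / L.weight N j * (D / (u / 2) ^ γ)) := by linarith
  have huγ : 0 < u ^ γ := Real.rpow_pos_of_pos hu0 _
  have h2γ : (0 : ℝ) < 2 ^ γ := by positivity
  calc L.weight N j / L.weight M j = u * (L.weight N j / L.weight K j) := by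
        rw [hu]; field_simp
    _ ≤ 2 * (L.weight K j / L.weight N j * (D / (u / 2) ^ γ)) * (L.weight N j / L.weight K j) :=
        mul_le_mul_of_nonneg_right h8 (div_pos hN hK).le
    _ = 2 * D * 2 ^ γ * u ^ (-γ) := by
        rw [Real.div_rpow hu0.le (by norm_num), Real.rpow_neg hu0.le]
        field_simp

theorem LpModel.weight_le_of_interpolates {I : Type*} (L : S.LpModel 1 I) {n m k : ℕ}
    {hnm : n ≤ m} {hmk : m ≤ k} {γ C : ℝ} (hC : 0 < C) (h : S.Interpolates hnm hmk γ C) (j : I) :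
    L.weight m j / L.weight n j ≤
      2 * C * (2 * C) ^ γ * (L.weight k j / L.weight m j) ^ γ := by
  classical
  have hn := L.weight_pos n j
  have hm := L.weight_pos m j
  have hk := L.weight_pos k j
  let δ : lp (fun _ : I => ℂ) 1 := lp.single (E := fun _ : I => ℂ) 1 j (1 : ℂ)
  have hnorm : ∀ {i : ℕ} (hi : n ≤ i), ‖S.incl hi ((L.equiv n).symm δ)‖ =
      L.weight i j / L.weight n j := by
    intro i hi
    have h1 : L.equiv i (S.incl hi ((L.equiv n).symm δ)) =
        lp.single (E := fun _ : I => ℂ) 1 j ((L.weight i j / L.weight n j : ℝ) : ℂ) := by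
      refine lp.ext (funext fun l => ?_)
      rw [L.equiv_incl, LinearIsometryEquiv.apply_symm_apply, lp.coeFn_single, lp.coeFn_single]
      rcases eq_or_ne l j with rfl | hl
      · simp
      · simp [hl]
    rw [← (L.equiv i).norm_map, h1, lp.norm_single zero_lt_one, Complex.norm_real,
      Real.norm_of_nonneg (div_pos (L.weight_pos i j) hn).le]
  set x := L.weight m j / L.weight n j with hx
  set w := L.weight k j / L.weight n j with hw
  have hx0 : 0 < x := div_pos hm hn
  have hw0 : 0 < w := div_pos hk hn
  -- For this `r` the last term of the interpolation inequality at a unit vector equals `x / 2` and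
  -- is absorbed on the left.
  have hr : 0 < x / (2 * C * w) := by positivity
  have h1 := h ((L.equiv n).symm δ) (x / (2 * C * w)) hr
  rw [hnorm hnm, hnorm (hnm.trans hmk), LinearIsometryEquiv.norm_map,
    lp.norm_single zero_lt_one, norm_one, mul_one] at h1
  have h2 : C * (x / (2 * C * w) * w) = x / 2 := by field_simp
  rw [mul_add, h2] at h1
  have h3 : (x / (2 * C * w)) ^ (-γ) = (2 * C) ^ γ * (L.weight k j / L.weight m j) ^ γ := by
    rw [Real.rpow_neg hr.le, ← Real.inv_rpow hr.le, ← Real.mul_rpow (by positivity) (by positivity)]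
    congr 1
    rw [hx, hw]
    field_simp
  rw [h3] at h1
  linarith

variable [TopologicalSpace E] [T2Space E]

/-- Approximation for spectra of `Z` consisting of weighted `ℓ^1`-spaces. -/
theorem LpModel.isApproximable_one [IsTopologicalAddGroup E] {I : Type*} (L : S.LpModel 1 I)
    (hΩ : S.CondDOmega) (hR : R.IsContinuous) (hA : R.CondA N) : S.IsApproximable R N := by
  classical
  intro n
  obtain ⟨m, hnm, hm⟩ := hΩ.exists_interpolates n
  refine ⟨m, hnm, fun k hmk A ε hε => ?_⟩
  obtain ⟨γ, hγ, C, hC, hint⟩ := hm k hmk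
  obtain ⟨M, hNM, A', hA'⟩ := hR.exists_factorization_ge N A
  obtain ⟨K, hMK, D, hD, hdec⟩ := hA M hNM γ hγ
  let δ : ∀ i, I → S.F i := fun i j =>
    (L.equiv i).symm (lp.single (E := fun _ : I => ℂ) 1 j (1 : ℂ))
  have hδ : ∀ i j, ‖δ i j‖ = 1 := fun i j => by
    rw [LinearIsometryEquiv.norm_map, lp.norm_single zero_lt_one, norm_one]
  have hexp : ∀ i (z : S.F i), HasSum (fun j => L.equiv i z j • δ i j) z := fun i z => by
    have := (hasSum_lp_one_single (L.equiv i z)).mapL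
      ((L.equiv i).symm.toContinuousLinearEquiv : lp (fun _ : I => ℂ) 1 →L[ℂ] S.F i)
    convert this using 2 with j
    · rw [map_smul]; rfl
    · exact ((L.equiv i).symm_apply_apply z).symm
  let x : I → ℝ := fun j => L.weight m j / L.weight n j
  let w : I → ℝ := fun j => L.weight k j / L.weight m j
  have hx : ∀ j, 0 < x j := fun j => div_pos (L.weight_pos m j) (L.weight_pos n j)
  have hw : ∀ j, 0 < w j := fun j => div_pos (L.weight_pos k j) (L.weight_pos m j)
  set σ := ‖A'‖ with hσ
  obtain ⟨ρ, hρ, hρε⟩ := exists_mul_rpow_neg_le hγ hε (D * σ * (2 * C * (2 * C) ^ γ))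
  -- Scaling by `w j` makes `y j / w j` bounded. Since `x j` is at most a constant times `w j ^ γ`,
  -- the weights cancel in the bound for `x j • v j` and leave `ρ ^ (-γ)`.
  choose y v hyv hy hv using fun j => hdec (ρ * w j) (mul_pos hρ (hw j)) (A' (δ m j))
  have hAδ : ∀ j, ‖A' (δ m j)‖ ≤ σ := fun j => by
    have := A'.le_opNorm (δ m j)
    rwa [hδ, mul_one] at this
  obtain ⟨U, -, hU⟩ := exists_clm_lone (fun j => ((w j : ℂ)⁻¹) • y j) (C := ρ * σ)
    (by positivity) fun j => by
      rw [norm_smul, norm_inv, Complex.norm_real, Real.norm_of_nonneg (hw j).le,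
        inv_mul_le_iff₀ (hw j)]
      refine (hy j).trans ((mul_le_mul_of_nonneg_left (hAδ j)
        (mul_pos hρ (hw j)).le).trans (le_of_eq ?_))
      ring
  obtain ⟨V, hVε, hV⟩ := exists_clm_lone (fun j => (x j : ℂ) • v j) (C := ε) hε.le fun j => by
    rw [norm_smul, Complex.norm_real, Real.norm_of_nonneg (hx j).le]
    have h1 : D / (ρ * w j) ^ γ * ‖A' (δ m j)‖ ≤ D / (ρ * w j) ^ γ * σ :=
      mul_le_mul_of_nonneg_left (hAδ j)
        (div_nonneg hD.le (Real.rpow_nonneg (mul_pos hρ (hw j)).le _))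
    have hwγ : 0 < w j ^ γ := Real.rpow_pos_of_pos (hw j) _
    have hργ : 0 < ρ ^ γ := Real.rpow_pos_of_pos hρ _
    calc x j * ‖v j‖ ≤ (2 * C * (2 * C) ^ γ * w j ^ γ) * (D / (ρ * w j) ^ γ * σ) := by
          refine mul_le_mul (L.weight_le_of_interpolates hC hint j) ((hv j).trans h1)
            (norm_nonneg _) (by positivity)
      _ = D * σ * (2 * C * (2 * C) ^ γ) * ρ ^ (-γ) := by
          rw [Real.mul_rpow hρ.le (hw j).le, Real.rpow_neg hρ.le]
          field_simp
      _ ≤ ε := hρε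
  refine ⟨(hR.ιL K).comp (U.comp ((L.equiv k).toContinuousLinearEquiv : S.F k →L[ℂ] _)),
    V.comp ((L.equiv n).toContinuousLinearEquiv : S.F n →L[ℂ] _), ?_, fun z => ?_⟩
  · refine ContinuousLinearMap.opNorm_le_bound _ hε.le fun z => ?_
    refine (V.le_of_opNorm_le hVε _).trans (le_of_eq ?_)
    congr 1
    exact (L.equiv n).norm_map z
  · have h1 := ((hexp m (S.incl hnm z)).mapL A').mapL (R.incl hMK)
    have h2 := hU (L.equiv k (S.incl (hnm.trans hmk) z))
    have h3 := (hV (L.equiv n z)).mapL (R.incl (hNM.trans hMK))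
    have h4 := h2.add h3
    have h5 : R.incl hMK (A' (S.incl hnm z)) = U (L.equiv k (S.incl (hnm.trans hmk) z)) +
        R.incl (hNM.trans hMK) (V (L.equiv n z)) := by
      refine h1.unique ?_
      convert h4 using 2 with j
      have h6 : R.incl hMK (A' (δ m j)) = y j + R.incl (hNM.trans hMK) (v j) :=
        R.ι_injective K (by simp only [map_add, R.ι_incl, hyv])
      have hwc : (w j : ℂ) ≠ 0 := by exact_mod_cast (hw j).ne'
      have h7 : ((L.weight k j / L.weight n j : ℝ) : ℂ) = x j * w j := by
        have h8 : (L.weight m j : ℂ) ≠ 0 := by exact_mod_cast (L.weight_pos m j).ne'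
        simp only [x, w]
        push_cast
        field_simp
      rw [map_smul, map_smul, h6, L.equiv_incl, L.equiv_incl, h7, map_smul, map_smul, smul_add,
        smul_smul, smul_smul]
      congr 2
      · simp only [x, w] at hwc ⊢
        field_simp
      · simp only [x]
        ring
    rw [← hA', ← R.ι_incl hMK, h5, map_add, R.ι_incl]
    rfl

/-- Approximation for spectra of `E` consisting of weighted `ℓ^∞`-spaces. -/
theorem LpModel.isApproximable_top [IsTopologicalAddGroup E] {I : Type*} (L : R.LpModel ∞ I)
    (hΩ : S.CondDOmega) (hR : R.IsContinuous) (hA : R.CondA N) : S.IsApproximable R N := by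
  intro n
  obtain ⟨m, hnm, hm⟩ := hΩ.exists_interpolates n
  refine ⟨m, hnm, fun k hmk A ε hε => ?_⟩
  obtain ⟨γ, hγ, C, hC, hint⟩ := hm k hmk
  obtain ⟨M, hNM, A', hA'⟩ := hR.exists_factorization_ge N A
  obtain ⟨K, hMK, D, hD, hdec⟩ := hA M hNM γ hγ
  let u : I → ℝ := fun j => L.weight K j / L.weight M j
  let q : I → ℝ := fun j => L.weight N j / L.weight M j
  have hu : ∀ j, 0 < u j := fun j => div_pos (L.weight_pos K j) (L.weight_pos M j)
  have hq : ∀ j, 0 < q j := fun j => div_pos (L.weight_pos N j) (L.weight_pos M j)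
  set σ := ‖A'‖ with hσ
  obtain ⟨ρ, hρ, hρε⟩ := exists_mul_rpow_neg_le hγ hε (2 * D * 2 ^ γ * (C * σ))
  let f : I → S.F m →L[ℂ] ℂ := fun j =>
    ((lpCoord ∞ j).comp ((L.equiv M).toContinuousLinearEquiv : R.F M →L[ℂ] _)).comp A'
  have hfz : ∀ j z, f j z = L.equiv M (A' z) j := fun j z => rfl
  have hf : ∀ j, ‖f j‖ ≤ σ := fun j => by
    refine ContinuousLinearMap.opNorm_le_bound _ (norm_nonneg _) fun z => ?_
    rw [hfz]
    refine (lp.norm_apply_le_norm ENNReal.top_ne_zero _ j).trans ?_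
    rw [LinearIsometryEquiv.norm_map]
    exact A'.le_opNorm z
  -- The dual choice: `r = ρ / u j` makes `u j • g j` bounded, and `q j`, at most a constant times
  -- `u j ^ (-γ)`, cancels the weight in the bound for `h j`.
  choose h g hh hg hsplit using fun j =>
    hint.exists_functional_split hC (f j) (r := ρ / u j) (div_pos hρ (hu j))
  obtain ⟨U, -, hU⟩ := exists_clm_linfty (fun j => (u j : ℂ) • g j) (C := C * ρ * σ)
    (by positivity) fun j => by
      rw [norm_smul, Complex.norm_real, Real.norm_of_nonneg (hu j).le]
      have h1 : ‖g j‖ ≤ C * (ρ / u j) * σ :=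
        (hg j).trans (mul_le_mul_of_nonneg_left (hf j)
          (mul_nonneg hC.le (div_pos hρ (hu j)).le))
      refine (mul_le_mul_of_nonneg_left h1 (hu j).le).trans (le_of_eq ?_)
      have := (hu j).ne'
      field_simp
  obtain ⟨V, hVε, hV⟩ := exists_clm_linfty (fun j => (q j : ℂ) • h j) (C := ε) hε.le fun j => by
    rw [norm_smul, Complex.norm_real, Real.norm_of_nonneg (hq j).le]
    have hpow : 0 < (ρ / u j) ^ (-γ) := Real.rpow_pos_of_pos (div_pos hρ (hu j)) _
    have huγ : 0 < u j ^ γ := Real.rpow_pos_of_pos (hu j) _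
    have hργ : 0 < ρ ^ γ := Real.rpow_pos_of_pos hρ _
    have h1 : ‖h j‖ ≤ C * (ρ / u j) ^ (-γ) * σ :=
      (hh j).trans (mul_le_mul_of_nonneg_left (hf j) (by positivity))
    calc q j * ‖h j‖ ≤ (2 * D * 2 ^ γ * u j ^ (-γ)) * (C * (ρ / u j) ^ (-γ) * σ) := by
          refine mul_le_mul (L.weight_le_of_condA hNM hMK hD hdec j) h1 (norm_nonneg _) ?_
          have : 0 < u j ^ (-γ) := Real.rpow_pos_of_pos (hu j) _
          positivity
      _ = 2 * D * 2 ^ γ * (C * σ) * ρ ^ (-γ) := by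
          rw [Real.div_rpow hρ.le (hu j).le, Real.rpow_neg hρ.le, Real.rpow_neg (hu j).le]
          field_simp
      _ ≤ ε := hρε
  refine ⟨(hR.ιL K).comp (((L.equiv K).symm.toContinuousLinearEquiv :
      lp (fun _ : I => ℂ) ∞ →L[ℂ] R.F K).comp U),
    ((L.equiv N).symm.toContinuousLinearEquiv : lp (fun _ : I => ℂ) ∞ →L[ℂ] R.F N).comp V,
    ?_, fun z => ?_⟩
  · refine ContinuousLinearMap.opNorm_le_bound _ hε.le fun z => ?_
    refine le_trans (le_of_eq ?_) (V.le_of_opNorm_le hVε z)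
    exact (L.equiv N).symm.norm_map (V z)
  · have h5 : R.incl hMK (A' (S.incl hnm z)) = (L.equiv K).symm (U (S.incl (hnm.trans hmk) z)) +
        R.incl (hNM.trans hMK) ((L.equiv N).symm (V z)) := by
      refine (L.equiv K).injective (lp.ext (funext fun j => ?_))
      rw [map_add, lp.coeFn_add, Pi.add_apply, L.equiv_incl, L.equiv_incl,
        LinearIsometryEquiv.apply_symm_apply, LinearIsometryEquiv.apply_symm_apply, hU, hV,
        ← hfz, hsplit]
      have h8 : (L.weight N j : ℂ) ≠ 0 := by exact_mod_cast (L.weight_pos N j).ne'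
      have h9 : (L.weight M j : ℂ) ≠ 0 := by exact_mod_cast (L.weight_pos M j).ne'
      simp only [smul_apply, smul_eq_mul, u, q]
      push_cast
      field_simp
      ring
    rw [← hA', ← R.ι_incl hMK, h5, map_add, R.ι_incl]
    rfl

end Approximation

end BanachSpectrum

/-! ### Approximation for nuclear inclusions. -/

/-- Summation of a double sequence of rank one operators. -/
theorem exists_hasSum_smul_prod {H G : Type*} [NormedAddCommGroup H] [NormedSpace ℂ H]
    [NormedAddCommGroup G] [NormedSpace ℂ G] [CompleteSpace G] (f : ℕ → ℕ → H →L[ℂ] ℂ)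
    (y : ℕ → ℕ → G) {α β : ℕ → ℝ} {s t : ℝ} (hα0 : ∀ l, 0 ≤ α l) (hβ0 : ∀ i, 0 ≤ β i)
    (hα : HasSum α s) (hβ : HasSum β t) (hle : ∀ l i, ‖f l i‖ * ‖y l i‖ ≤ α l * β i) :
    ∃ T : H →L[ℂ] G, ‖T‖ ≤ s * t ∧
      ∀ x, HasSum (fun p : ℕ × ℕ => f p.1 p.2 x • y p.1 p.2) (T x) := by
  have h0 : Summable fun p : ℕ × ℕ => α p.1 * β p.2 :=
    Summable.mul_of_nonneg (f := α) (g := β) hα.summable hβ.summable hα0 hβ0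
  have h1 : HasSum (fun p : ℕ × ℕ => α p.1 * β p.2) (s * t) := HasSum.mul hα hβ h0
  have hle' : ∀ p : ℕ × ℕ, ‖f p.1 p.2‖ * ‖y p.1 p.2‖ ≤ α p.1 * β p.2 := fun p => hle p.1 p.2
  have h2 : Summable fun p : ℕ × ℕ => ‖f p.1 p.2‖ * ‖y p.1 p.2‖ :=
    Summable.of_nonneg_of_le (fun _ => mul_nonneg (norm_nonneg _) (norm_nonneg _)) hle' h0
  have h3 : ∑' p : ℕ × ℕ, ‖f p.1 p.2‖ * ‖y p.1 p.2‖ ≤ s * t := hasSum_le hle' h2.hasSum h1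
  obtain ⟨T, hT, hT'⟩ := exists_hasSum_smul_of_summable (J := ℕ × ℕ) (fun p => f p.1 p.2)
    (fun p => y p.1 p.2) h2.hasSum
  exact ⟨T, hT.trans h3, hT'⟩

namespace BanachSpectrum

section Nuclear

variable {Z : Type*} [AddCommGroup Z] [Module ℂ Z] {S : BanachSpectrum Z}

/-- A functional on the step `m` is, on the smaller step `n`, a sum of functionals that are
continuous on the step `k`, with geometric control of both norms. -/
theorem Interpolates.exists_decomposition {n m k : ℕ} {hnm : n ≤ m} {hmk : m ≤ k} {γ C : ℝ}
    (hγ : 0 < γ) (hC : 0 < C) (h : S.Interpolates hnm hmk γ C) (f : S.F m →L[ℂ] ℂ) :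
    ∃ g : ℕ → S.F k →L[ℂ] ℂ, (∀ i, ‖g i‖ ≤ 2 * C * 2 ^ i * ‖f‖) ∧
      (∀ i, ‖(g i).comp (S.incl (hnm.trans hmk))‖ ≤
        (C * ‖S.incl (hnm.trans hmk)‖ + C * (2 ^ γ + 1)) * ((2 : ℝ) ^ (-γ)) ^ i * ‖f‖) ∧
      ∀ z, Tendsto (fun i => ∑ j ∈ Finset.range i, g j (S.incl (hnm.trans hmk) z)) atTop
        (𝓝 (f (S.incl hnm z))) := by
  set q : ℝ := (2 : ℝ) ^ (-γ) with hq
  have hq0 : 0 < q := by positivity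
  have hq1 : q < 1 := Real.rpow_lt_one_of_one_lt_of_neg one_lt_two (by linarith)
  have hqγ : (2 : ℝ) ^ γ * q = 1 := by
    rw [hq, ← Real.rpow_add two_pos, add_neg_cancel, Real.rpow_zero]
  choose b a hb ha hab using fun i : ℕ =>
    h.exists_functional_split hC f (r := 2 ^ i) (by positivity)
  have hqi : ∀ i : ℕ, ((2 : ℝ) ^ i) ^ (-γ) = q ^ i := fun i => by
    rw [hq, ← Real.rpow_natCast, ← Real.rpow_natCast, ← Real.rpow_mul two_pos.le,
      ← Real.rpow_mul two_pos.le, mul_comm]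
  simp only [hqi] at hb
  -- Telescoping the splittings at `r = 2 ^ i`: `g (i + 1)` has size `2 ^ i` on step `k`, but on
  -- step `n` it equals `b i - b (i + 1)`, which decays like `2 ^ (-γ i)`.
  let g : ℕ → S.F k →L[ℂ] ℂ := fun i => Nat.casesOn i (a 0) fun i => a (i + 1) - a i
  have hg : ∀ i z, ∑ j ∈ Finset.range (i + 1), g j z = a i z := by
    intro i z
    induction i with
    | zero => simp [g]
    | succ i ih =>
      rw [Finset.sum_range_succ, ih]
      simp [g]
  refine ⟨g, ?_, ?_, fun z => ?_⟩
  · rintro (_ | i)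
    · refine (ha 0).trans ?_
      have : 0 ≤ C * ‖f‖ := by positivity
      simp only [pow_zero]
      linarith
    · refine (norm_sub_le _ _).trans ((add_le_add (ha _) (ha _)).trans ?_)
      have : 0 ≤ C * 2 ^ i * ‖f‖ := by positivity
      rw [pow_succ]
      linarith
  · rintro (_ | i)
    · refine (ContinuousLinearMap.opNorm_comp_le _ _).trans
        ((mul_le_mul_of_nonneg_right (ha 0) (norm_nonneg _)).trans ?_)
      have : 0 ≤ C * (2 ^ γ + 1) * ‖f‖ := by positivity
      simp only [pow_zero, mul_one]
      linarith
    · have h1 : (g (i + 1)).comp (S.incl (hnm.trans hmk)) = b i - b (i + 1) := by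
        ext z
        have h2 := hab i z
        rw [hab (i + 1) z] at h2
        simp only [g, ContinuousLinearMap.comp_apply, sub_apply]
        linear_combination h2
      rw [h1]
      refine (norm_sub_le _ _).trans ((add_le_add (hb _) (hb _)).trans ?_)
      have h3 : C * (2 ^ γ + 1) * q ^ (i + 1) * ‖f‖ = C * q ^ i * ‖f‖ + C * q ^ (i + 1) * ‖f‖ := by
        rw [pow_succ]
        linear_combination C * q ^ i * ‖f‖ * hqγ
      have h4 : 0 ≤ C * ‖S.incl (hnm.trans hmk)‖ * q ^ (i + 1) * ‖f‖ := by positivity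
      rw [add_mul, add_mul, h3]
      linarith
  · rw [← tendsto_add_atTop_iff_nat 1]
    simp only [hg]
    have h1 : ∀ i, a i (S.incl (hnm.trans hmk) z) = f (S.incl hnm z) - b i z := fun i => by
      rw [hab i z]; ring
    simp only [h1]
    have h2 : Tendsto (fun i => b i z) atTop (𝓝 0) := by
      refine squeeze_zero_norm (a := fun i => C * q ^ i * ‖f‖ * ‖z‖)
        (fun i => (b i).le_of_opNorm_le (hb i) z) ?_
      have := (((tendsto_pow_atTop_nhds_zero_of_lt_one hq0.le hq1).const_mul C).mul_const
        ‖f‖).mul_const ‖z‖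
      simpa using this
    simpa using tendsto_const_nhds.sub h2

variable {E : Type*} [AddCommGroup E] [Module ℂ E] {R : BanachSpectrum E} {N : ℕ}

/-- Splitting of nuclear operators. -/
theorem Interpolates.exists_nuclear_split {n m k : ℕ} {hnm : n ≤ m} {hmk : m ≤ k} {γ C : ℝ}
    (hγ : 0 < γ) (hC : 0 < C) (h : S.Interpolates hnm hmk γ C) (hA : R.CondA N) {M : ℕ}
    (hNM : N ≤ M) (f : ℕ → S.F m →L[ℂ] ℂ) (e : ℕ → R.F M)
    (hfe : Summable fun l => ‖f l‖ * ‖e l‖) {ε : ℝ} (hε : 0 < ε) :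
    ∃ (K : ℕ) (U : S.F k →L[ℂ] R.F K) (V : S.F n →L[ℂ] R.F N), ‖V‖ ≤ ε ∧
      ∀ z t, HasSum (fun l => f l (S.incl hnm z) • e l) t →
        R.ι M t = R.ι K (U (S.incl (hnm.trans hmk) z)) + R.ι N (V z) := by
  -- With radii `ρ 4 ^ (-i)`, the terms on step `k` are of order `2 ^ i 4 ^ (-i)`. Those on step `n`
  -- are of order `2 ^ (-γ i) 4 ^ (γ i / 4) = p ^ i`, so both series converge.
  obtain ⟨K, hMK, D, hD, hdec⟩ := hA M hNM (γ / 4) (by positivity)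
  choose g hg hgi hgsum using fun l => h.exists_decomposition hγ hC (f l)
  set J := S.incl (hnm.trans hmk) with hJ
  set B := C * ‖J‖ + C * (2 ^ γ + 1) with hB
  have hB0 : 0 ≤ B := by positivity
  set p : ℝ := (2 : ℝ) ^ (-(γ / 2)) with hp
  have hp0 : 0 < p := by positivity
  have hp1 : p < 1 := Real.rpow_lt_one_of_one_lt_of_neg one_lt_two (by linarith)
  have hp2 : (2 : ℝ) ^ (-γ) = p * p := by
    rw [hp, ← Real.rpow_add two_pos]
    congr 1
    ring
  have hp4 : ∀ i : ℕ, ((1 / 4 : ℝ) ^ i) ^ (γ / 4) = p ^ i := fun i => by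
    rw [hp, ← Real.rpow_natCast, ← Real.rpow_natCast, ← Real.rpow_mul (by norm_num), mul_comm,
      Real.rpow_mul (by norm_num)]
    congr 1
    rw [show (1 / 4 : ℝ) = 2 ^ (-2 : ℝ) by norm_num [Real.rpow_neg], ← Real.rpow_mul two_pos.le]
    congr 1
    ring
  set σ := ∑' l, ‖f l‖ * ‖e l‖ with hσ
  have hσs : HasSum (fun l => ‖f l‖ * ‖e l‖) σ := hfe.hasSum
  have hσ0 : 0 ≤ σ := hσs.nonneg fun l => by positivity
  obtain ⟨ρ, hρ, hρε⟩ := exists_mul_rpow_neg_le (show 0 < γ / 4 by positivity) hε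
    (σ * (1 - p)⁻¹ * (B * D))
  choose u v huv hu hv using fun (l i : ℕ) =>
    hdec (ρ * (1 / 4) ^ i) (by positivity) (e l)
  have hα : ∀ l, 0 ≤ ‖f l‖ * ‖e l‖ := fun l => by positivity
  obtain ⟨U, -, hUsum⟩ := exists_hasSum_smul_prod g u hα
    (fun i => show 0 ≤ 2 * C * ρ * (1 / 2 : ℝ) ^ i by positivity) hσs
    (hasSum_geometric_two.mul_left (2 * C * ρ)) fun l i => by
      refine (mul_le_mul (hg l i) (hu l i) (norm_nonneg _) (by positivity)).trans (le_of_eq ?_)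
      have h2 : (2 : ℝ) ^ i * (1 / 4) ^ i = (1 / 2) ^ i := by
        rw [← mul_pow]; norm_num
      linear_combination 2 * C * ‖f l‖ * ρ * ‖e l‖ * h2
  obtain ⟨V, hVn, hVsum⟩ := exists_hasSum_smul_prod (fun l i => (g l i).comp J) v hα
    (fun i => show 0 ≤ B * D * ρ ^ (-(γ / 4)) * p ^ i by positivity) hσs
    ((hasSum_geometric_of_lt_one hp0.le hp1).mul_left (B * D * ρ ^ (-(γ / 4)))) fun l i => by
      refine (mul_le_mul (hgi l i) (hv l i) (norm_nonneg _) (by positivity)).trans (le_of_eq ?_)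
      have hpi : p ^ i ≠ 0 := (pow_pos hp0 i).ne'
      have hρ' : ρ ^ (γ / 4) ≠ 0 := by positivity
      rw [Real.mul_rpow hρ.le (by positivity), hp4, Real.rpow_neg hρ.le, hp2, mul_pow]
      field_simp
  refine ⟨K, U, V, hVn.trans (le_trans (le_of_eq ?_) hρε), fun z t ht => ?_⟩
  · ring
  · have h1 : HasSum (fun x : ℕ × ℕ => g x.1 x.2 (J z) • R.incl hMK (e x.1))
        (U (J z) + R.incl (hNM.trans hMK) (V z)) := by
      convert (hUsum (J z)).add ((hVsum z).mapL (R.incl (hNM.trans hMK))) using 2 with x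
      rw [map_smul, ContinuousLinearMap.comp_apply, ← smul_add]
      congr 1
      exact R.ι_injective K (by simp only [map_add, R.ι_incl, huv x.1 x.2])
    have h2 : ∀ l, HasSum (fun i => g l i (J z)) (f l (S.incl hnm z)) := fun l => by
      have h3 : Summable fun i => g l i (J z) := by
        refine Summable.of_norm_bounded (g := fun i => B * (p * p) ^ i * ‖f l‖ * ‖z‖)
          (((((summable_geometric_of_lt_one (by positivity) (by nlinarith)).mul_left
            B)).mul_right ‖f l‖).mul_right ‖z‖) fun i => ?_
        have := ((g l i).comp J).le_of_opNorm_le (hgi l i) z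
        rwa [hp2] at this
      exact h3.hasSum_iff_tendsto_nat.2 (hgsum l z)
    have h4 := h1.prod_fiberwise fun l => (h2 l).smul_const (R.incl hMK (e l))
    have h5 := ht.mapL (R.incl hMK)
    simp only [map_smul] at h5
    rw [← R.ι_incl hMK, h5.unique h4, map_add, R.ι_incl]

variable [TopologicalSpace E] [T2Space E]

/-- Approximation for spectra of `Z` with nuclear inclusion maps. -/
theorem CondDOmega.isApproximable_of_isNuclearMap (hΩ : S.CondDOmega)
    (hnuc : ∀ n, IsNuclearMap (S.incl (Nat.le_succ n))) (hR : R.IsContinuous) (hA : R.CondA N) :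
    S.IsApproximable R N := by
  intro n
  obtain ⟨m, hnm, hm⟩ := hΩ.exists_interpolates n
  -- The extra step makes room for the nuclear inclusion from `m` to `m + 1`, which gives `A` a
  -- nuclear representation with functionals on step `m`.
  refine ⟨m + 1, hnm.trans (Nat.le_succ m), fun k hmk A ε hε => ?_⟩
  obtain ⟨γ, hγ, C, hC, hint⟩ := hm k ((Nat.le_succ m).trans hmk)
  obtain ⟨M, hNM, A', hA'⟩ := hR.exists_factorization_ge N A
  obtain ⟨f, y, hs, hsum⟩ := hnuc m
  have hfe : Summable fun l => ‖f l‖ * ‖A' (y l)‖ := by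
    refine Summable.of_nonneg_of_le (fun l => by positivity) (fun l => ?_) (hs.mul_left ‖A'‖)
    rw [mul_left_comm]
    exact mul_le_mul_of_nonneg_left (A'.le_opNorm _) (norm_nonneg _)
  obtain ⟨K, U, V, hV, hUV⟩ := hint.exists_nuclear_split hγ hC hA hNM f _ hfe hε
  refine ⟨(hR.ιL K).comp U, V, hV, fun z => ?_⟩
  have h1 := (hsum (S.incl hnm z)).mapL A'
  simp only [map_smul] at h1
  have h2 := hUV z _ h1
  rw [incl_incl, hA'] at h2
  exact h2

/-- Approximation for spectra of `E` with nuclear inclusion maps. -/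
theorem CondDOmega.isApproximable_of_isNuclearMap_target (hΩ : S.CondDOmega)
    (hR : R.IsContinuous) (hnuc : ∀ n, IsNuclearMap (R.incl (Nat.le_succ n))) (hA : R.CondA N) :
    S.IsApproximable R N := by
  intro n
  obtain ⟨m, hnm, hm⟩ := hΩ.exists_interpolates n
  refine ⟨m, hnm, fun k hmk A ε hε => ?_⟩
  obtain ⟨γ, hγ, C, hC, hint⟩ := hm k hmk
  obtain ⟨M, hNM, A', hA'⟩ := hR.exists_factorization_ge N A
  obtain ⟨f, y, hs, hsum⟩ := hnuc M
  have hfe : Summable fun l => ‖(f l).comp A'‖ * ‖y l‖ := by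
    refine Summable.of_nonneg_of_le (fun l => by positivity) (fun l => ?_) (hs.mul_left ‖A'‖)
    rw [← mul_assoc, mul_comm ‖A'‖]
    exact mul_le_mul_of_nonneg_right (ContinuousLinearMap.opNorm_comp_le _ _) (norm_nonneg _)
  obtain ⟨K, U, V, hV, hUV⟩ :=
    -- Here `A'` followed by the nuclear inclusion into step `M + 1` of `R` is the nuclear operator
    -- to be split.
    hint.exists_nuclear_split hγ hC hA (hNM.trans (Nat.le_succ M)) _ _ hfe hε
  refine ⟨(hR.ιL K).comp U, V, hV, fun z => ?_⟩
  have h2 := hUV z _ (hsum (A' (S.incl hnm z)))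
  rw [R.ι_incl, hA'] at h2
  exact h2

end Nuclear

end BanachSpectrum

end

/-! ### Assembly of the four cases. -/

theorem mainTheorem4
    (E : Type uE) [AddCommGroup E] [Module ℂ E] [TopologicalSpace E] [IsTopologicalAddGroup E]
    [ContinuousSMul ℂ E] [LocallyConvexSpace ℝ E] [T2Space E]
    (hE : IsLocallyComplete E) (hB : ∃ B : ℕ → Set E, IsFundamentalSeq B)
    (Z : Type uZ) [AddCommGroup Z] [Module ℂ Z] [TopologicalSpace Z] (hZ : IsLB Z)
    (hcases : IsKSpace ∞ E ∨ IsLN E ∨ IsKSpace 1 Z ∨ IsLN Z)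
    (hA : CondA E) (hDΩ : CondDOmega Z) :
    IsWeaklyAcyclic.{uX, uY} E Z := by

  intro X _ _ _ Y _ _ _ hX hY ι Q hι hex hQ T
  obtain ⟨-, SX, hSX⟩ := hX
  obtain ⟨hY2, SY, hSY⟩ := hY
  have hZ2 := hZ.1
  have hSX := hSX.isContinuous
  obtain ⟨S₀, hS₀, hΩ₀⟩ := hDΩ
  have hS₀ := hS₀.isContinuous
  -- In the first two cases the special spectrum is that of `E`, and `Z` keeps the spectrum from
  -- (DΩ). In the last two it is that of `Z`, so (DΩ) is transferred to it and `E` gets a spectrum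
  -- of Banach disks.
  rcases hcases with h | ⟨-, R, hR, hnuc⟩ | h | ⟨-, S, hS, hnuc⟩
  · obtain ⟨R, hR, I, ⟨L⟩⟩ := h.exists_lpModel
    obtain ⟨N, hA⟩ := hR.condA hE hA
    exact exists_extension_of_local hR hS₀ (L.isApproximable_top hΩ₀ hR hA) hSY ι Q hex hQ T
      (L.exists_local_extension hSX hSY.isContinuous hR ι Q hι hex T)
  · have hR := hR.isContinuous
    obtain ⟨N, hA⟩ := hR.condA hE hA
    exact exists_extension_of_local hR hS₀
      (hΩ₀.isApproximable_of_isNuclearMap_target hR hnuc hA) hSY ι Q hex hQ T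
      (exists_local_extension_of_isNuclearMap hSX hSY.isContinuous hR hnuc ι Q hι hex T)
  · obtain ⟨S, hS, I, ⟨L⟩⟩ := h.exists_lpModel
    obtain ⟨B, hB⟩ := hB
    obtain ⟨R, hR⟩ := hE.exists_spectrum hB
    obtain ⟨N, hA⟩ := hR.condA hE hA
    exact exists_extension_of_local hR hS
      (L.isApproximable_one (hS₀.condDOmega hS hΩ₀) hR hA) hSY ι Q hex hQ T
      (exists_local_extension_of_lift hSX hSY.isContinuous hS ι Q hι hex
        (L.exists_lift hSY.isContinuous hS Q hQ) T)
  · have hS := hS.isContinuous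
    obtain ⟨B, hB⟩ := hB
    obtain ⟨R, hR⟩ := hE.exists_spectrum hB
    obtain ⟨N, hA⟩ := hR.condA hE hA
    exact exists_extension_of_local hR hS
      ((hS₀.condDOmega hS hΩ₀).isApproximable_of_isNuclearMap hnuc hR hA) hSY ι Q hex hQ T
      (exists_local_extension_of_lift hSX hSY.isContinuous hS ι Q hι hex
        (exists_lift_of_isNuclearMap hSY.isContinuous hS hnuc Q hQ) T)
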